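/- Let $\mathsf K$ be a field of characteristic $0$. For $n\ge 0$ let $\Omega_n=\mathsf K[t_0,\dots,t_n,dt_0,\dots,dt_n]/(t_0+\cdots+t_n-1,\;dt_0+\cdots+dt_n)$ be the dg commutative algebra of polynomial differential forms on the $n$-simplex ($t_i$ of degree $0$, $dt_i$ of degree $1$, $d(t_i)=dt_i$). These form a simplicial dg commutative algebra $\Omega_\bullet$, with $f^*t_i=\sum_{f(j)=i}t_j$. Let $$P_n\omega=\sum_{k=0}^n\ \sum_{i_0<\dots<i_k} I_{i_0\dots i_k}(\omega)\,\omega_{i_0\dots i_k},\qquad \omega_{i_0\dots i_k}=k!\sum_{j=0}^k(-1)^j\,t_{i_j}\,dt_{i_0}\cdots\widehat{dt_{i_j}}\cdots dt_{i_k},$$ be Whitney's projection, where $I_{i_0\dots i_k}(\omega)$ is the (formal) integral of $\omega$ over the $k$-simplex spanned by the vertices $e_{i_0},\dots,e_{i_k}$. Fix a gauge $s_\bullet$, that is, a simplicial $\mathsf K$-linear endomorphism $s_\bullet:\Omega_\bullet^*\to\Omega_\bullet^{*-1}$ of degree $-1$ such that $\mathrm{Id}-P_\bullet=ds_\bullet+s_\bullet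 d$ and $(s_\bullet)^2=0$. For a nilpotent $L_\infty$-algebra $\mathfrak g$ over $\mathsf K$, with operations $[x_1,\dots,x_k]$ of degree $2-k$ and $\delta x=[x]$, let $\gamma_\bullet(\mathfrak g)$ be the simplicial set whose $n$-simplices are the elements $\alpha\in\mathfrak g\otimes\Omega_n$ of total degree $1$ which satisfy the Maurer–Cartan equation $$(d+\delta)\alpha+\sum_{\ell\ge2}\frac1{\ell!}[\alpha,\dots,\alpha]=0$$ (with $\ell$ entries $\alpha$ in the $\ell$-th term) and the gauge condition $s_n\alpha=0$; it is a functor of $\mathfrak g$ with respect to strict morphisms (linear maps of degree $0$ which preserve all the operations). For a cochain complex $V$ of $\mathsf K$-vector spaces, let $K_\bullet(V)$ be the simplicial set (Dold–Kan functor) whose $n$-simplices are the morphisms of complexes $C_*(\Delta^n)\to V$, where $C_*(\Delta^n)$ is the complex of normalized simplicial chains of the simplicial set $\Delta^n$ with coefficients in $\mathsf K$, with $C_k(\Delta^n)$ placed in cohomological degree $-k$. An $L_\infty$-algebra is called abelian if $[x_1,\dots,x_k]=0$ for all $k>1$; it is then nilpotent, and is the same thing as a cochain complex $(\mathfrak g,\delta)$.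 **Proposition.** For every gauge $s_\bullet$, there is an isomorphism of simplicial sets $$\gamma_\bullet(\mathfrak g)\;\cong\;K_\bullet(\mathfrak g[1]),\qquad \mathfrak g[1]^i=\mathfrak g^{i+1},$$ natural in the abelian $L_\infty$-algebra $\mathfrak g$; that is, the functors $\mathfrak g\mapsto\gamma_\bullet(\mathfrak g)$ and $\mathfrak g\mapsto K_\bullet(\mathfrak g[1])$ from abelian $L_\infty$-algebras to simplicial sets are isomorphic. -/

import Mathlib

open TensorProduct CategoryTheory Opposite

universe u

noncomputable section

/-! ### Polynomial differential forms on simplices -/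

namespace PolyForm

variable (K : Type u) [Field K]

/-- The ideal of `K[t₀, …, tₙ]` generated by `t₀ + ⋯ + tₙ - 1`. -/
def simplexIdeal (n : ℕ) : Ideal (MvPolynomial (Fin (n + 1)) K) :=
  Ideal.span {∑ i, MvPolynomial.X i - 1}

/-- The coordinate ring `K[t₀, …, tₙ] / (t₀ + ⋯ + tₙ - 1)` of the `n`-simplex. -/
def Coord (n : ℕ) : Type u := MvPolynomial (Fin (n + 1)) K ⧸ simplexIdeal K n

instance (n : ℕ) : CommRing (Coord K n) :=
  inferInstanceAs (CommRing (MvPolynomial (Fin (n + 1)) K ⧸ simplexIdeal K n))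

instance (n : ℕ) : Algebra K (Coord K n) :=
  inferInstanceAs (Algebra K (MvPolynomial (Fin (n + 1)) K ⧸ simplexIdeal K n))

/-- The class of a polynomial in the coordinate ring. -/
def Coord.mk (n : ℕ) : MvPolynomial (Fin (n + 1)) K →ₐ[K] Coord K n :=
  Ideal.Quotient.mkₐ K (simplexIdeal K n)

/-- The `K`-span of `dt₀, …, dtₙ`, subject to the relation `dt₀ + ⋯ + dtₙ = 0`. -/
def Cotangent (n : ℕ) : Type u :=
  (Fin (n + 1) → K) ⧸ Submodule.span K {(fun _ => 1 : Fin (n + 1) → K)}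

instance (n : ℕ) : AddCommGroup (Cotangent K n) :=
  inferInstanceAs (AddCommGroup
    ((Fin (n + 1) → K) ⧸ Submodule.span K {(fun _ => 1 : Fin (n + 1) → K)}))

instance (n : ℕ) : Module K (Cotangent K n) :=
  inferInstanceAs (Module K
    ((Fin (n + 1) → K) ⧸ Submodule.span K {(fun _ => 1 : Fin (n + 1) → K)}))

/-- The class of `∑ vᵢ dtᵢ`. -/
def Cotangent.mk (n : ℕ) : (Fin (n + 1) → K) →ₗ[K] Cotangent K n :=
  Submodule.mkQ (Submodule.span K {(fun _ => 1 : Fin (n + 1) → K)})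

/-- The graded commutative algebra
`Ωₙ = K[t₀, …, tₙ, dt₀, …, dtₙ] / (t₀ + ⋯ + tₙ - 1, dt₀ + ⋯ + dtₙ)`. The coordinates `tᵢ` have
degree `0` and the `dtᵢ` anticommute, so this is the tensor product of the coordinate ring with the
exterior algebra on the `dtᵢ` (no signs occur, the first factor being in degree `0`). -/
abbrev Forms (n : ℕ) : Type u := Coord K n ⊗[K] ExteriorAlgebra K (Cotangent K n)

def coord {n : ℕ} (i : Fin (n + 1)) : Coord K n := Coord.mk K n (MvPolynomial.X i)

def covec {n : ℕ} (i : Fin (n + 1)) : Cotangent K n := Cotangent.mk K n (Pi.single i 1)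

/-- The form `tᵢ`. -/
def t {n : ℕ} (i : Fin (n + 1)) : Forms K n := coord K i ⊗ₜ 1

/-- The form `dtᵢ`. -/
def dt {n : ℕ} (i : Fin (n + 1)) : Forms K n := 1 ⊗ₜ ExteriorAlgebra.ι K (covec K i)

lemma coord_relation (n : ℕ) : Coord.mk K n (∑ i, MvPolynomial.X i - 1) = 0 :=
  Ideal.Quotient.eq_zero_iff_mem.2 (Ideal.subset_span rfl)

lemma coord_surjective (n : ℕ) : Function.Surjective (Coord.mk K n) :=
  Ideal.Quotient.mk_surjective

lemma sum_coord (n : ℕ) : ∑ i : Fin (n + 1), coord K i = 1 := by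
  have := coord_relation K n
  rw [map_sub, map_sum, map_one, sub_eq_zero] at this
  exact this

lemma sum_covec (n : ℕ) : ∑ i : Fin (n + 1), covec K i = 0 := by
  simp only [covec]
  rw [← map_sum, Finset.univ_sum_single]
  exact (Submodule.Quotient.mk_eq_zero _).2 (Submodule.subset_span rfl)

/-- A linear map out of the polynomial ring which kills the ideal, viewed on the quotient. -/
def liftCoord {n : ℕ} {M : Type u} [AddCommGroup M] [Module K M]
    (φ : MvPolynomial (Fin (n + 1)) K →ₗ[K] M)
    (h : ∀ q, φ ((∑ i, MvPolynomial.X i - 1) * q) = 0) : Coord K n →ₗ[K] M :=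
  Submodule.liftQ ((simplexIdeal K n).restrictScalars K) φ (by
    intro p hp
    obtain ⟨q, rfl⟩ := Ideal.mem_span_singleton.1 hp
    exact h q) ∘ₗ
  (Submodule.Quotient.restrictScalarsEquiv K (simplexIdeal K n)).symm.toLinearMap

lemma liftCoord_mk {n : ℕ} {M : Type u} [AddCommGroup M] [Module K M]
    (φ : MvPolynomial (Fin (n + 1)) K →ₗ[K] M)
    (h : ∀ q, φ ((∑ i, MvPolynomial.X i - 1) * q) = 0) (p : MvPolynomial (Fin (n + 1)) K) :
    liftCoord K φ h (Coord.mk K n p) = φ p := rfl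

/-- `p ↦ dp = ∑ᵢ (∂p/∂tᵢ) dtᵢ` on polynomials. -/
def diffPoly (n : ℕ) : MvPolynomial (Fin (n + 1)) K →ₗ[K] Forms K n :=
  ∑ i, ((TensorProduct.mk K (Coord K n) (ExteriorAlgebra K (Cotangent K n))).flip
    (ExteriorAlgebra.ι K (covec K i))) ∘ₗ
    (Coord.mk K n).toLinearMap ∘ₗ (MvPolynomial.pderiv i).toLinearMap

lemma diffPoly_apply {n : ℕ} (p : MvPolynomial (Fin (n + 1)) K) :
    diffPoly K n p = ∑ i, Coord.mk K n (MvPolynomial.pderiv i p) ⊗ₜ[K]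
      ExteriorAlgebra.ι K (covec K i) := by
  simp [diffPoly]

lemma diffPoly_relation {n : ℕ} (q : MvPolynomial (Fin (n + 1)) K) :
    diffPoly K n ((∑ i, MvPolynomial.X i - 1) * q) = 0 := by
  have hX : ∀ i : Fin (n + 1), MvPolynomial.pderiv i
      (∑ j, MvPolynomial.X j - 1 : MvPolynomial (Fin (n + 1)) K) = 1 := by
    intro i
    simp [map_sum, MvPolynomial.pderiv_X, Pi.single_apply]
  have : ∀ i : Fin (n + 1), Coord.mk K n
      (MvPolynomial.pderiv i ((∑ j, MvPolynomial.X j - 1) * q)) = Coord.mk K n q := by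
    intro i
    rw [Derivation.leibniz, hX, smul_eq_mul, smul_eq_mul, map_add, map_mul, coord_relation,
      zero_mul, zero_add, mul_one]
  rw [diffPoly_apply]
  simp only [this]
  rw [← TensorProduct.tmul_sum, ← map_sum, sum_covec, map_zero, TensorProduct.tmul_zero]

/-- The exterior differential of functions. -/
def diffCoord (n : ℕ) : Coord K n →ₗ[K] Forms K n :=
  liftCoord K (diffPoly K n) (diffPoly_relation K)

lemma diffCoord_mk {n : ℕ} (p : MvPolynomial (Fin (n + 1)) K) :
    diffCoord K n (Coord.mk K n p) = diffPoly K n p := rfl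

/-- The exterior differential `d : Ωₙ → Ωₙ`, `d(r dt_{i₁} ⋯ dt_{iₚ}) = dr dt_{i₁} ⋯ dt_{iₚ}`. -/
def d (n : ℕ) : Forms K n →ₗ[K] Forms K n :=
  TensorProduct.lift ((LinearMap.mul K (Forms K n)).compl₁₂ (diffCoord K n)
    (Algebra.TensorProduct.includeRight :
      ExteriorAlgebra K (Cotangent K n) →ₐ[K] Forms K n).toLinearMap)

lemma d_tmul {n : ℕ} (r : Coord K n) (w : ExteriorAlgebra K (Cotangent K n)) :
    d K n (r ⊗ₜ w) = diffCoord K n r * (1 ⊗ₜ w) := rfl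

lemma diffCoord_coord {n : ℕ} (i : Fin (n + 1)) : diffCoord K n (coord K i) = dt K i := by
  rw [coord, diffCoord_mk, diffPoly_apply, dt, Finset.sum_eq_single i]
  · rw [MvPolynomial.pderiv_X_self, map_one]
  · intro j _ hj
    rw [MvPolynomial.pderiv_X_of_ne (Ne.symm hj), map_zero, TensorProduct.zero_tmul]
  · simp

lemma d_t {n : ℕ} (i : Fin (n + 1)) : d K n (t K i) = dt K i := by
  rw [t, d_tmul, diffCoord_coord, ← Algebra.TensorProduct.one_def, mul_one]

lemma diffCoord_mul {n : ℕ} (r s : Coord K n) :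
    diffCoord K n (r * s) = (r ⊗ₜ 1) * diffCoord K n s + (s ⊗ₜ 1) * diffCoord K n r := by
  obtain ⟨p, rfl⟩ := coord_surjective K n r
  obtain ⟨q, rfl⟩ := coord_surjective K n s
  rw [← map_mul, diffCoord_mk, diffCoord_mk, diffCoord_mk]
  simp only [diffPoly_apply, Finset.mul_sum, ← Finset.sum_add_distrib,
    Algebra.TensorProduct.tmul_mul_tmul, one_mul, ← TensorProduct.add_tmul, ← map_mul, ← map_add]
  simp [Derivation.leibniz]

lemma diffCoord_algebraMap (n : ℕ) (a : K) : diffCoord K n (algebraMap K (Coord K n) a) = 0 := by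
  have : algebraMap K (Coord K n) a = Coord.mk K n (MvPolynomial.C a) := rfl
  rw [this, diffCoord_mk, diffPoly_apply]
  simp

/-- The space `Ωₙᵖ` of forms of degree `p`. -/
def degreePart (n p : ℕ) : Submodule K (Forms K n) :=
  LinearMap.range (TensorProduct.map (LinearMap.id : Coord K n →ₗ[K] Coord K n)
    (⋀[K]^p (Cotangent K n)).subtype)

/-- The involution of `Ωₙ` which is `(-1)ᵖ` on `Ωₙᵖ`. -/
def formParity (n : ℕ) : Forms K n →ₐ[K] Forms K n :=
  Algebra.TensorProduct.map (AlgHom.id K (Coord K n)) (ExteriorAlgebra.map (-LinearMap.id))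

/-! The (simplicial) action of maps between vertices: `f^* tᵢ = ∑_{f j = i} tⱼ`. -/

def pullbackCoord {m n : ℕ} (f : Fin (m + 1) → Fin (n + 1)) : Coord K n →ₐ[K] Coord K m :=
  Ideal.Quotient.liftₐ (simplexIdeal K n)
    (MvPolynomial.aeval fun i => ∑ j with f j = i, coord K j) (by
      intro p hp
      obtain ⟨q, rfl⟩ := Ideal.mem_span_singleton.1 hp
      have : (MvPolynomial.aeval fun i => ∑ j with f j = i, coord K j)
          (∑ i, MvPolynomial.X i - 1 : MvPolynomial (Fin (n + 1)) K) = 0 := by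
        simp only [map_sub, map_sum, MvPolynomial.aeval_X, map_one]
        rw [Finset.sum_fiberwise, sum_coord, sub_self]
      rw [map_mul, this, zero_mul])

def pullbackCovec {m n : ℕ} (f : Fin (m + 1) → Fin (n + 1)) :
    Cotangent K n →ₗ[K] Cotangent K m :=
  Submodule.mapQ _ _ (LinearMap.funLeft K K f) (by
    rw [Submodule.span_le]
    rintro _ rfl
    exact Submodule.subset_span rfl)

/-- The map of algebras `f^* : Ωₙ → Ωₘ` induced by a map of vertices, that is, the pullback of
forms along the affine map which sends the vertex `eⱼ` to `e_{f j}`; it satisfies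
`f^* tᵢ = ∑_{f j = i} tⱼ` and `f^* dtᵢ = ∑_{f j = i} dtⱼ`. -/
def pullback {m n : ℕ} (f : Fin (m + 1) → Fin (n + 1)) : Forms K n →ₐ[K] Forms K m :=
  Algebra.TensorProduct.map (pullbackCoord K f) (ExteriorAlgebra.map (pullbackCovec K f))

lemma pullbackCoord_coord {m n : ℕ} (f : Fin (m + 1) → Fin (n + 1)) (i : Fin (n + 1)) :
    pullbackCoord K f (coord K i) = ∑ j with f j = i, coord K j :=
  MvPolynomial.aeval_X _ i

lemma pullbackCovec_covec {m n : ℕ} (f : Fin (m + 1) → Fin (n + 1)) (i : Fin (n + 1)) :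
    pullbackCovec K f (covec K i) = ∑ j with f j = i, covec K j := by
  simp only [covec]
  rw [← map_sum]
  refine congrArg (Cotangent.mk K m) ?_
  funext j
  simp [LinearMap.funLeft_apply, Finset.sum_apply, Pi.single_apply, Finset.sum_ite_eq]

lemma pullback_tmul {m n : ℕ} (f : Fin (m + 1) → Fin (n + 1)) (r : Coord K n)
    (w : ExteriorAlgebra K (Cotangent K n)) :
    pullback K f (r ⊗ₜ[K] w) =
      pullbackCoord K f r ⊗ₜ[K] ExteriorAlgebra.map (pullbackCovec K f) w :=
  rfl

lemma pullback_t {m n : ℕ} (f : Fin (m + 1) → Fin (n + 1)) (i : Fin (n + 1)) :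
    pullback K f (t K i) = ∑ j with f j = i, t K j := by
  simp only [t, pullback_tmul, pullbackCoord_coord, map_one, TensorProduct.sum_tmul]

lemma pullback_dt {m n : ℕ} (f : Fin (m + 1) → Fin (n + 1)) (i : Fin (n + 1)) :
    pullback K f (dt K i) = ∑ j with f j = i, dt K j := by
  simp only [dt, pullback_tmul, map_one, ExteriorAlgebra.map_apply_ι, pullbackCovec_covec,
    map_sum, TensorProduct.tmul_sum]

lemma algHom_coord_ext {n : ℕ} {A : Type u} [CommRing A] [Algebra K A]
    {f g : Coord K n →ₐ[K] A} (h : ∀ i, f (coord K i) = g (coord K i)) : f = g := by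
  apply Ideal.Quotient.algHom_ext
  apply MvPolynomial.algHom_ext
  intro i
  exact h i

lemma pullbackCoord_id (n : ℕ) :
    pullbackCoord K (id : Fin (n + 1) → Fin (n + 1)) = AlgHom.id K (Coord K n) :=
  algHom_coord_ext K fun i => by
    rw [pullbackCoord_coord]
    simp [Finset.filter_eq']

lemma pullbackCovec_id (n : ℕ) :
    pullbackCovec K (id : Fin (n + 1) → Fin (n + 1)) = LinearMap.id := by
  ext x
  obtain ⟨v, rfl⟩ := Submodule.Quotient.mk_surjective _ x
  rfl

lemma pullbackCoord_comp {l m n : ℕ} (f : Fin (m + 1) → Fin (n + 1))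
    (g : Fin (l + 1) → Fin (m + 1)) :
    pullbackCoord K (f ∘ g) = (pullbackCoord K g).comp (pullbackCoord K f) :=
  algHom_coord_ext K fun i => by
    rw [AlgHom.comp_apply, pullbackCoord_coord, pullbackCoord_coord, map_sum]
    simp only [pullbackCoord_coord]
    rw [← Finset.sum_fiberwise_of_maps_to (s := {j | (f ∘ g) j = i}) (g := g)
      (t := {j | f j = i}) (by intro x; simp)]
    refine Finset.sum_congr rfl fun j hj => ?_
    refine Finset.sum_congr ?_ fun _ _ => rfl
    ext x
    simp only [Finset.mem_filter, Finset.mem_univ, true_and, Function.comp_apply] at hj ⊢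
    exact ⟨fun h => h.2, fun h => ⟨by rw [h, hj], h⟩⟩

lemma pullbackCovec_comp {l m n : ℕ} (f : Fin (m + 1) → Fin (n + 1))
    (g : Fin (l + 1) → Fin (m + 1)) :
    pullbackCovec K (f ∘ g) = pullbackCovec K g ∘ₗ pullbackCovec K f := by
  ext x
  obtain ⟨v, rfl⟩ := Submodule.Quotient.mk_surjective _ x
  rfl

lemma pullback_id (n : ℕ) :
    pullback K (id : Fin (n + 1) → Fin (n + 1)) = AlgHom.id K (Forms K n) := by
  rw [pullback, pullbackCoord_id, pullbackCovec_id, ExteriorAlgebra.map_id,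
    Algebra.TensorProduct.map_id]

lemma pullback_comp {l m n : ℕ} (f : Fin (m + 1) → Fin (n + 1))
    (g : Fin (l + 1) → Fin (m + 1)) :
    pullback K (f ∘ g) = (pullback K g).comp (pullback K f) := by
  rw [pullback, pullbackCoord_comp, pullbackCovec_comp, ← ExteriorAlgebra.map_comp_map,
    Algebra.TensorProduct.map_comp]
  rfl

lemma pullback_diffCoord {m n : ℕ} (f : Fin (m + 1) → Fin (n + 1)) (r : Coord K n) :
    pullback K f (diffCoord K n r) = diffCoord K m (pullbackCoord K f r) := by
  obtain ⟨p, rfl⟩ := coord_surjective K n r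
  induction p using MvPolynomial.induction_on with
  | C a =>
    have : Coord.mk K n (MvPolynomial.C a) = algebraMap K _ a := rfl
    rw [this, AlgHom.commutes, diffCoord_algebraMap, diffCoord_algebraMap, map_zero]
  | add p q hp hq => rw [map_add, map_add, map_add, hp, hq, map_add, map_add]
  | mul_X p i hp =>
    have hi : Coord.mk K n (MvPolynomial.X i) = coord K i := rfl
    rw [map_mul, hi, diffCoord_mul, map_add, map_mul, map_mul, hp, map_mul, diffCoord_mul,
      pullback_tmul, pullback_tmul, pullbackCoord_coord, diffCoord_coord, pullback_dt, map_sum]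
    simp only [diffCoord_coord, map_one]

lemma pullback_d {m n : ℕ} (f : Fin (m + 1) → Fin (n + 1)) (x : Forms K n) :
    pullback K f (d K n x) = d K m (pullback K f x) := by
  induction x using TensorProduct.induction_on with
  | zero => simp only [map_zero]
  | add x y hx hy => simp only [map_add, hx, hy]
  | tmul r w =>
    rw [d_tmul, map_mul, pullback_diffCoord, pullback_tmul, pullback_tmul, d_tmul, map_one]

lemma pullback_formParity {m n : ℕ} (f : Fin (m + 1) → Fin (n + 1)) (x : Forms K n) :
    pullback K f (formParity K n x) = formParity K m (pullback K f x) := by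
  have h : (pullback K f).comp (formParity K n) = (formParity K m).comp (pullback K f) := by
    rw [formParity, formParity, pullback, ← Algebra.TensorProduct.map_comp,
      ← Algebra.TensorProduct.map_comp, ExteriorAlgebra.map_comp_map, ExteriorAlgebra.map_comp_map]
    have : pullbackCovec K f ∘ₗ (-LinearMap.id) = (-LinearMap.id) ∘ₗ pullbackCovec K f := by
      rw [LinearMap.comp_neg, LinearMap.neg_comp, LinearMap.comp_id, LinearMap.id_comp]
    rw [this]
    rfl
  exact DFunLike.congr_fun h x

lemma map_mem_exteriorPower {V W : Type u} [AddCommGroup V] [AddCommGroup W] [Module K V]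
    [Module K W] (φ : V →ₗ[K] W) {p : ℕ} {w : ExteriorAlgebra K V} (hw : w ∈ ⋀[K]^p V) :
    ExteriorAlgebra.map φ w ∈ ⋀[K]^p W := by
  rw [← ExteriorAlgebra.ιMulti_span_fixedDegree] at hw ⊢
  refine Submodule.span_induction ?_ ?_ ?_ ?_ hw
  · rintro _ ⟨v, rfl⟩
    rw [ExteriorAlgebra.map_apply_ιMulti]
    exact Submodule.subset_span ⟨_, rfl⟩
  · rw [map_zero]
    exact zero_mem _
  · intro a b _ _ ha hb
    rw [map_add]
    exact add_mem ha hb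
  · intro a b _ hb
    rw [map_smul]
    exact Submodule.smul_mem _ _ hb

lemma pullback_mem_degreePart {m n p : ℕ} (f : Fin (m + 1) → Fin (n + 1)) {x : Forms K n}
    (hx : x ∈ degreePart K n p) : pullback K f x ∈ degreePart K m p := by
  obtain ⟨y, rfl⟩ := hx
  induction y with
  | zero =>
    rw [map_zero, map_zero]
    exact zero_mem _
  | add x y hx hy =>
    rw [map_add, map_add]
    exact add_mem hx hy
  | tmul r w => exact ⟨pullbackCoord K f r ⊗ₜ ⟨_, map_mem_exteriorPower K _ w.2⟩, rfl⟩

/-! ### Integration and elementary forms -/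

/-- The integral over the standard `k`-simplex (for the form `dt₁ ⋯ dtₖ`), on polynomials:
`∫ t₀^{a₀} ⋯ tₖ^{aₖ} dt₁ ⋯ dtₖ = a₀! ⋯ aₖ! / (a₀ + ⋯ + aₖ + k)!`. -/
def dirichletPoly (k : ℕ) : MvPolynomial (Fin (k + 1)) K →ₗ[K] K :=
  (MvPolynomial.basisMonomials (Fin (k + 1)) K).constr K fun a =>
    (∏ i, ((a i).factorial : K)) / ((∑ i, a i + k).factorial : K)

lemma dirichletPoly_monomial {k : ℕ} (a : Fin (k + 1) →₀ ℕ) :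
    dirichletPoly K k (MvPolynomial.monomial a 1) =
      (∏ i, ((a i).factorial : K)) / ((∑ i, a i + k).factorial : K) :=
  Module.Basis.constr_basis (MvPolynomial.basisMonomials (Fin (k + 1)) K) K _ a

lemma dirichletPoly_X_mul {k : ℕ} (i : Fin (k + 1)) (a : Fin (k + 1) →₀ ℕ) :
    dirichletPoly K k (MvPolynomial.X i * MvPolynomial.monomial a 1) =
      ((a i + 1 : ℕ) : K) * ((∏ i, ((a i).factorial : K)) /
        ((∑ i, a i + k + 1).factorial : K)) := by
  rw [MvPolynomial.X, MvPolynomial.monomial_mul, one_mul, dirichletPoly_monomial]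
  have h1 : ∑ j, (Finsupp.single i 1 + a : Fin (k + 1) →₀ ℕ) j + k = ∑ j, a j + k + 1 := by
    simp only [Finsupp.add_apply, Finset.sum_add_distrib, Finsupp.single_apply, Finset.sum_ite_eq,
      Finset.mem_univ, if_true]
    omega
  have h2 : ∏ j, (((Finsupp.single i 1 + a : Fin (k + 1) →₀ ℕ) j).factorial : K) =
      ((a i + 1 : ℕ) : K) * ∏ j, ((a j).factorial : K) := by
    rw [← Finset.mul_prod_erase _ _ (Finset.mem_univ i),
      ← Finset.mul_prod_erase _ (fun j => ((a j).factorial : K)) (Finset.mem_univ i),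
      ← mul_assoc]
    congr 1
    · rw [Finsupp.add_apply, Finsupp.single_eq_same, add_comm 1, Nat.factorial_succ, Nat.cast_mul]
    · refine Finset.prod_congr rfl fun j hj => ?_
      simp [(Finset.ne_of_mem_erase hj).symm]
  rw [h1, h2, mul_div_assoc]

lemma dirichletPoly_relation [CharZero K] {k : ℕ} (q : MvPolynomial (Fin (k + 1)) K) :
    dirichletPoly K k ((∑ i, MvPolynomial.X i - 1) * q) = 0 := by
  have h : dirichletPoly K k ∘ₗ LinearMap.mulLeft K
      (∑ i, MvPolynomial.X i - 1 : MvPolynomial (Fin (k + 1)) K) = 0 := by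
    refine (MvPolynomial.basisMonomials (Fin (k + 1)) K).ext fun a => ?_
    rw [MvPolynomial.coe_basisMonomials, LinearMap.comp_apply, LinearMap.mulLeft_apply, sub_mul,
      one_mul, Finset.sum_mul, map_sub, map_sum, dirichletPoly_monomial, LinearMap.zero_apply,
      Finset.sum_congr rfl fun i _ => dirichletPoly_X_mul K i a, ← Finset.sum_mul, ← Nat.cast_sum]
    have h3 : ∑ i, (a i + 1) = ∑ i, a i + k + 1 := by
      simp [Finset.sum_add_distrib]
      omega
    have h4 : ((∑ i, a i + k + 1 : ℕ) : K) ≠ 0 := Nat.cast_ne_zero.2 (Nat.succ_ne_zero _)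
    have h5 : ((∑ i, a i + k).factorial : K) ≠ 0 := Nat.cast_ne_zero.2 (Nat.factorial_ne_zero _)
    rw [h3, Nat.factorial_succ, Nat.cast_mul, sub_eq_zero]
    field_simp
  exact DFunLike.congr_fun h q

/-- The integral of a function on the standard `k`-simplex with respect to `dt₁ ⋯ dtₖ`. -/
def dirichlet [CharZero K] (k : ℕ) : Coord K k →ₗ[K] K :=
  liftCoord K (dirichletPoly K k) (dirichletPoly_relation K)

/-- The pairing of a constant one-form with the edges `e_b - e₀`, `b = 1, …, k`. -/
def edgePairing (k : ℕ) : Cotangent K k →ₗ[K] (Fin k → K) :=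
  Submodule.liftQ (Submodule.span K {(fun _ => 1 : Fin (k + 1) → K)})
    (LinearMap.funLeft K K Fin.succ - LinearMap.funLeft K K fun _ : Fin k => (0 : Fin (k + 1)))
    (by
      rw [Submodule.span_le]
      rintro _ rfl
      exact sub_self _)

lemma edgePairing_mk {k : ℕ} (v : Fin (k + 1) → K) (b : Fin k) :
    edgePairing K k (Cotangent.mk K k v) b = v b.succ - v 0 := rfl

/-- The coefficient of `dt₁ ⋯ dtₖ` in a constant form on the `k`-simplex. -/
def topCoeff (k : ℕ) : ExteriorAlgebra K (Cotangent K k) →ₗ[K] K :=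
  ExteriorAlgebra.liftAlternating
    (Pi.single k ((Matrix.detRowAlternating (n := Fin k) (R := K)).compLinearMap (edgePairing K k)))

/-- The integral of a form over the standard `k`-simplex. -/
def integralTop [CharZero K] (k : ℕ) : Forms K k →ₗ[K] K :=
  LinearMap.mul' K K ∘ₗ TensorProduct.map (dirichlet K k) (topCoeff K k)

/-- The integral `I_{i₀ ⋯ iₖ}` of a form on the `n`-simplex over the `k`-chain spanned by the
vertices `e_{i₀}, …, e_{iₖ}`. -/
def integral [CharZero K] {n k : ℕ} (i : Fin (k + 1) → Fin (n + 1)) : Forms K n →ₗ[K] K :=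
  integralTop K k ∘ₗ (pullback K i).toLinearMap

/-- The elementary form
`ω_{i₀ ⋯ iₖ} = k! ∑ⱼ (-1)ʲ t_{iⱼ} dt_{i₀} ⋯ (without dt_{iⱼ}) ⋯ dt_{iₖ}`. -/
def elementary {n k : ℕ} (i : Fin (k + 1) → Fin (n + 1)) : Forms K n :=
  (k.factorial : K) • ∑ j : Fin (k + 1),
    (-1 : K) ^ (j : ℕ) • (t K (i j) * (List.ofFn fun l : Fin k => dt K (i (j.succAbove l))).prod)

open Classical in
/-- Whitney's projection `Pₙ ω = ∑ₖ ∑_{i₀ < ⋯ < iₖ} I_{i₀ ⋯ iₖ}(ω) ω_{i₀ ⋯ iₖ}` onto the space of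
elementary forms. -/
def whitney [CharZero K] (n : ℕ) : Forms K n →ₗ[K] Forms K n :=
  ∑ k ∈ Finset.range (n + 1), ∑ i : Fin (k + 1) → Fin (n + 1) with StrictMono i,
    (integral K i).smulRight (elementary K i)

/-- A gauge: a simplicial `K`-linear endomorphism `s` of degree `-1` of the polynomial forms on
simplices such that `id - P = ds + sd` and `s² = 0`. -/
structure Gauge [CharZero K] where
  s : ∀ n : ℕ, Forms K n →ₗ[K] Forms K n
  degree_zero : ∀ n : ℕ, ∀ x ∈ degreePart K n 0, s n x = 0
  degree_succ : ∀ n p : ℕ, ∀ x ∈ degreePart K n (p + 1), s n x ∈ degreePart K n p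
  simplicial : ∀ {m n : ℕ} (f : Fin (m + 1) → Fin (n + 1)), Monotone f →
    ∀ x : Forms K n, pullback K f (s n x) = s m (pullback K f x)
  contraction : ∀ (n : ℕ) (x : Forms K n), x - whitney K n x = d K n (s n x) + s n (d K n x)
  square_zero : ∀ (n : ℕ) (x : Forms K n), s n (s n x) = 0

end PolyForm

/-! ### `L∞`-algebras -/

/-- The Koszul sign of the action of the permutation `π` on elements of degrees `deg`: a factor
`(-1)^{|xᵢ| |xⱼ|}` for every pair of elements whose order is exchanged. -/
def koszulSign {n : ℕ} (deg : Fin n → ℤ) (π : Equiv.Perm (Fin n)) : ℤˣ :=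
  ∏ p : Fin n × Fin n with p.1 < p.2 ∧ π p.2 < π p.1, (deg (π p.1) * deg (π p.2)).negOnePow

/-- The permutations `π` of `n` letters with `π 1 < ⋯ < π k` and `π (k+1) < ⋯ < π n`. -/
def shuffles (k n : ℕ) : Finset (Equiv.Perm (Fin n)) :=
  {π | ∀ a b : Fin n, a < b → ((b : ℕ) < k ∨ k ≤ (a : ℕ)) → π a < π b}

/-- An `L∞`-algebra over `K`: a graded vector space with graded antisymmetric operations
`[x₁, …, xₖ]`, `k > 0`, of degree `2 - k`, which satisfy the `n`-Jacobi rules for `n > 0`.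
(The operation `bracket 0`, which is not part of the structure, is set to zero.) -/
structure LInfinityAlgebra (K : Type u) [Field K] where
  carrier : Type u
  [addCommGroup : AddCommGroup carrier]
  [module : Module K carrier]
  gr : ℤ → Submodule K carrier
  isInternal : DirectSum.IsInternal gr
  bracket : ∀ k : ℕ, MultilinearMap K (fun _ : Fin k => carrier) carrier
  bracket_zero : bracket 0 = 0
  bracket_mem : ∀ (k : ℕ) (deg : Fin k → ℤ) (x : Fin k → carrier), (∀ i, x i ∈ gr (deg i)) →
    bracket k x ∈ gr (∑ i, deg i + 2 - k)
  antisymm : ∀ (k : ℕ) (deg : Fin k → ℤ) (x : Fin k → carrier), (∀ i, x i ∈ gr (deg i)) →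
    ∀ i j : Fin k, (i : ℕ) + 1 = j →
      bracket k x + (deg i * deg j).negOnePow • bracket k (x ∘ Equiv.swap i j) = 0
  jacobi : ∀ (n : ℕ) (deg : Fin n → ℤ) (x : Fin n → carrier), (∀ i, x i ∈ gr (deg i)) →
    ∑ l : Fin n, (-1 : ℤˣ) ^ ((l : ℕ) + 1) • ∑ π ∈ shuffles ((l : ℕ) + 1) n,
      (Equiv.Perm.sign π * koszulSign deg π) •
        bracket (n - ((l : ℕ) + 1) + 1)
          (Fin.cons
            (bracket ((l : ℕ) + 1) fun a => x (π ⟨a, by omega⟩))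
            (fun b => x (π ⟨(l : ℕ) + 1 + b, by omega⟩))) = 0

namespace LInfinityAlgebra

variable {K : Type u} [Field K]

attribute [instance] LInfinityAlgebra.addCommGroup LInfinityAlgebra.module

/-- A (strict) morphism of `L∞`-algebras: a linear map of degree `0` which commutes with all the
operations. -/
@[ext]
structure Hom (g h : LInfinityAlgebra K) where
  toLin : g.carrier →ₗ[K] h.carrier
  map_gr : ∀ (i : ℤ) (x : g.carrier), x ∈ g.gr i → toLin x ∈ h.gr i
  map_bracket : ∀ (k : ℕ) (x : Fin k → g.carrier),
    toLin (g.bracket k x) = h.bracket k fun i => toLin (x i)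

instance : Category (LInfinityAlgebra K) where
  Hom := Hom
  id g := ⟨LinearMap.id, fun _ _ h => h, fun _ _ => rfl⟩
  comp f₁ f₂ := ⟨f₂.toLin ∘ₗ f₁.toLin, fun i x hx => f₂.map_gr i _ (f₁.map_gr i x hx),
    fun k x => by
      rw [LinearMap.comp_apply, f₁.map_bracket, f₂.map_bracket]
      rfl⟩

/-- The operation `δ x = [x]`. -/
def delta (g : LInfinityAlgebra K) : g.carrier →ₗ[K] g.carrier :=
  (MultilinearMap.ofSubsingleton K g.carrier g.carrier (0 : Fin 1)).symm (g.bracket 1)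

lemma delta_apply (g : LInfinityAlgebra K) (x : g.carrier) :
    g.delta x = g.bracket 1 fun _ => x := rfl

lemma delta_mem (g : LInfinityAlgebra K) {i : ℤ} {x : g.carrier} (hx : x ∈ g.gr i) :
    g.delta x ∈ g.gr (i + 1) := by
  have := g.bracket_mem 1 (fun _ => i) (fun _ => x) (fun _ => hx)
  rw [delta_apply]
  convert this using 2
  simp
  ring

lemma shuffles_one : shuffles 1 1 = {1} := by
  decide

lemma delta_delta (g : LInfinityAlgebra K) {i : ℤ} {x : g.carrier} (hx : x ∈ g.gr i) :
    g.delta (g.delta x) = 0 := by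
  have h := g.jacobi 1 (fun _ => i) (fun _ => x) (fun _ => hx)
  rw [Fin.sum_univ_one] at h
  have h1 : shuffles (((0 : Fin 1) : ℕ) + 1) 1 = {1} := shuffles_one
  rw [h1, Finset.sum_singleton, smul_smul, smul_eq_zero_iff_eq] at h
  exact (congrArg (g.bracket 1) (funext fun i => by rw [Subsingleton.elim i 0]; rfl)).trans h

lemma map_delta {g h : LInfinityAlgebra K} (f : Hom g h) (x : g.carrier) :
    f.toLin (g.delta x) = h.delta (f.toLin x) :=
  f.map_bracket 1 _

/-- `x ∈ Fⁱ g`, where `F` is the lower central filtration: `F¹ g = g`, and `Fⁱ g` is spanned by the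
`[F^{i₁} g, …, F^{iₖ} g]` with `i₁ + ⋯ + iₖ = i`. -/
inductive LowerCentral (g : LInfinityAlgebra K) : ℕ → g.carrier → Prop
  | one (x : g.carrier) : LowerCentral g 1 x
  | zero (i : ℕ) : LowerCentral g i 0
  | add {i : ℕ} {x y : g.carrier} :
      LowerCentral g i x → LowerCentral g i y → LowerCentral g i (x + y)
  | smul {i : ℕ} (a : K) {x : g.carrier} : LowerCentral g i x → LowerCentral g i (a • x)
  | bracket {k : ℕ} (i : Fin k → ℕ) (x : Fin k → g.carrier) :
      (∀ j, 0 < i j) → (∀ j, LowerCentral g (i j) (x j)) →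
      LowerCentral g (∑ j, i j) (g.bracket k x)

/-- `g` is nilpotent: `Fⁱ g = 0` for `i ≫ 0`. -/
def IsNilpotent (g : LInfinityAlgebra K) : Prop :=
  ∃ N : ℕ, ∀ i, N ≤ i → ∀ x, g.LowerCentral i x → x = 0

/-- `g` is abelian: `[x₁, …, xₖ]` vanishes for `k > 1`. -/
def IsAbelian (g : LInfinityAlgebra K) : Prop :=
  ∀ k, 1 < k → g.bracket k = 0

lemma IsNilpotent.bracket_eq_zero {g : LInfinityAlgebra K} (hg : g.IsNilpotent) :
    ∃ N : ℕ, ∀ k, N ≤ k → g.bracket k = 0 := by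
  obtain ⟨N, hN⟩ := hg
  refine ⟨N, fun k hk => ?_⟩
  ext x
  have := LowerCentral.bracket (g := g) (fun _ : Fin k => 1) x (fun _ => one_pos)
    (fun j => LowerCentral.one (x j))
  rw [Finset.sum_const, Finset.card_univ, Fintype.card_fin, smul_eq_mul, mul_one] at this
  exact hN k hk _ this

lemma IsAbelian.isNilpotent {g : LInfinityAlgebra K} (hg : g.IsAbelian) : g.IsNilpotent := by
  refine ⟨2, fun i hi x hx => ?_⟩
  induction hx with
  | one x => omega
  | zero i => rfl
  | add _ _ h1 h2 => rw [h1 hi, h2 hi, add_zero]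
  | smul a _ h => rw [h hi, smul_zero]
  | @bracket k i x hpos _ h =>
    match k, i, x, hpos, h with
    | 0, i, x, _, _ => rw [g.bracket_zero]; rfl
    | 1, i, x, _, h =>
      have : x 0 = 0 := h 0 (by simpa using hi)
      exact (g.bracket 1).map_coord_zero 0 this
    | k + 2, i, x, _, _ => rw [hg (k + 2) (by omega)]; rfl

/-- The involution of `g` which is `(-1)ⁱ` on `gⁱ`. -/
def parity (g : LInfinityAlgebra K) : g.carrier →ₗ[K] g.carrier :=
  DirectSum.toModule K ℤ g.carrier (fun i => ((i.negOnePow : ℤ) : K) • (g.gr i).subtype) ∘ₗ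
    (LinearEquiv.ofBijective (DirectSum.coeLinearMap g.gr) g.isInternal).symm.toLinearMap

lemma parity_of_mem (g : LInfinityAlgebra K) {i : ℤ} {x : g.carrier} (hx : x ∈ g.gr i) :
    g.parity x = ((i.negOnePow : ℤ) : K) • x := by
  have : (LinearEquiv.ofBijective (DirectSum.coeLinearMap g.gr) g.isInternal).symm x =
      DirectSum.lof K ℤ (fun i => g.gr i) i ⟨x, hx⟩ := by
    rw [LinearEquiv.symm_apply_eq]
    exact (DirectSum.coeLinearMap_lof g.gr i ⟨x, hx⟩).symm
  rw [parity, LinearMap.comp_apply, LinearEquiv.coe_coe, this, DirectSum.toModule_lof]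
  rfl

lemma induction_homogeneous (g : LInfinityAlgebra K) {p : g.carrier → Prop} (h0 : p 0)
    (hadd : ∀ x y, p x → p y → p (x + y)) (hmem : ∀ i, ∀ x ∈ g.gr i, p x) (x : g.carrier) :
    p x := by
  have hx : x ∈ ⨆ i, g.gr i := by
    rw [g.isInternal.submodule_iSup_eq_top]
    trivial
  exact Submodule.iSup_induction g.gr (motive := p) hx hmem h0 hadd

lemma map_parity {g h : LInfinityAlgebra K} (f : Hom g h) (x : g.carrier) :
    f.toLin (g.parity x) = h.parity (f.toLin x) := by
  refine g.induction_homogeneous (p := fun x => f.toLin (g.parity x) = h.parity (f.toLin x))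
    ?_ ?_ ?_ x
  · simp only [map_zero]
  · intro x y hx hy
    simp only [map_add, hx, hy]
  · intro i x hx
    rw [g.parity_of_mem hx, h.parity_of_mem (f.map_gr i x hx), map_smul]

end LInfinityAlgebra

/-! ### Tensor products of multilinear maps -/

section TensorMultilinear

variable (K : Type u) [Field K] {V A W B : Type u} [AddCommGroup V] [Module K V]
  [AddCommGroup A] [Module K A] [AddCommGroup W] [Module K W] [AddCommGroup B] [Module K B]

/-- The tensor product of two multilinear maps `φ` and `ψ` in the same number of variables,
without signs: `(x₁ ⊗ a₁, …, xₖ ⊗ aₖ) ↦ φ (x₁, …, xₖ) ⊗ ψ (a₁, …, aₖ)`. -/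
def multilinearTensor : ∀ k : ℕ,
    MultilinearMap K (fun _ : Fin k => V) W →ₗ[K] MultilinearMap K (fun _ : Fin k => A) B →ₗ[K]
      MultilinearMap K (fun _ : Fin k => V ⊗[K] A) (W ⊗[K] B)
  | 0 => LinearMap.mk₂ K
      (fun φ ψ => MultilinearMap.constOfIsEmpty K _ (φ Fin.elim0 ⊗ₜ[K] ψ Fin.elim0))
      (by intros; ext; simp [TensorProduct.add_tmul])
      (by intros; ext; simp [TensorProduct.smul_tmul'])
      (by intros; ext; simp [TensorProduct.tmul_add])
      (by intros; ext; simp)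
  | k + 1 => LinearMap.mk₂ K
      (fun φ ψ => (multilinearCurryLeftEquiv K (fun _ : Fin (k + 1) => V ⊗[K] A) (W ⊗[K] B)).symm
        (TensorProduct.lift ((multilinearTensor k).compl₁₂
          (multilinearCurryLeftEquiv K (fun _ : Fin (k + 1) => V) W φ)
          (multilinearCurryLeftEquiv K (fun _ : Fin (k + 1) => A) B ψ))))
      (by
        intro φ φ' ψ
        rw [← map_add]
        congr 1
        refine TensorProduct.ext' fun x a => ?_
        have : (φ + φ').curryLeft x = φ.curryLeft x + φ'.curryLeft x := rfl
        simp [this])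
      (by
        intro c φ ψ
        rw [← map_smul]
        congr 1
        refine TensorProduct.ext' fun x a => ?_
        simp)
      (by
        intro φ ψ ψ'
        rw [← map_add]
        congr 1
        refine TensorProduct.ext' fun x a => ?_
        have : (ψ + ψ').curryLeft a = ψ.curryLeft a + ψ'.curryLeft a := rfl
        simp [this])
      (by
        intro c φ ψ
        rw [← map_smul]
        congr 1
        refine TensorProduct.ext' fun x a => ?_
        simp)

lemma multilinearTensor_tmul (k : ℕ) (φ : MultilinearMap K (fun _ : Fin k => V) W)
    (ψ : MultilinearMap K (fun _ : Fin k => A) B) (x : Fin k → V) (a : Fin k → A) :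
    multilinearTensor K k φ ψ (fun i => x i ⊗ₜ a i) = φ x ⊗ₜ ψ a := by
  induction k with
  | zero =>
    rw [Subsingleton.elim x Fin.elim0, Subsingleton.elim a Fin.elim0]
    rfl
  | succ k ih =>
    have h := ih (φ.curryLeft (x 0)) (ψ.curryLeft (a 0)) (Fin.tail x) (Fin.tail a)
    rw [MultilinearMap.curryLeft_apply, MultilinearMap.curryLeft_apply, Fin.cons_self_tail,
      Fin.cons_self_tail] at h
    exact h

lemma multilinear_ext_tmul {k : ℕ} {F G : MultilinearMap K (fun _ : Fin k => V ⊗[K] A) W}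
    (h : ∀ (x : Fin k → V) (a : Fin k → A), F (fun i => x i ⊗ₜ a i) = G (fun i => x i ⊗ₜ a i)) :
    F = G := by
  induction k with
  | zero =>
    ext z
    have := h Fin.elim0 Fin.elim0
    rwa [Subsingleton.elim (fun i : Fin 0 => (Fin.elim0 i : V) ⊗ₜ[K] (Fin.elim0 i : A)) z] at this
  | succ k ih =>
    refine (multilinearCurryLeftEquiv K (fun _ : Fin (k + 1) => V ⊗[K] A) W).injective ?_
    refine TensorProduct.ext' fun x a => ih fun y b => ?_
    have := h (Fin.cons x y) (Fin.cons a b)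
    have hc : (fun i => (Fin.cons x y : Fin (k + 1) → V) i ⊗ₜ[K] (Fin.cons a b : Fin (k + 1) → A) i)
        = Fin.cons (x ⊗ₜ[K] a) (fun i => y i ⊗ₜ[K] b i) := by
      funext i
      refine Fin.cases rfl (fun i => rfl) i
    rwa [hc] at this

lemma multilinearTensor_natural {V' A' W' B' : Type u} [AddCommGroup V'] [Module K V']
    [AddCommGroup A'] [Module K A'] [AddCommGroup W'] [Module K W'] [AddCommGroup B'] [Module K B']
    {k : ℕ} {φ : MultilinearMap K (fun _ : Fin k => V) W}
    {ψ : MultilinearMap K (fun _ : Fin k => A) B}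
    {φ' : MultilinearMap K (fun _ : Fin k => V') W'}
    {ψ' : MultilinearMap K (fun _ : Fin k => A') B'}
    (α : V →ₗ[K] V') (β : A →ₗ[K] A') (γ : W →ₗ[K] W') (ε : B →ₗ[K] B')
    (h : ∀ x, γ (φ x) = φ' fun i => α (x i)) (h' : ∀ a, ε (ψ a) = ψ' fun i => β (a i))
    (z : Fin k → V ⊗[K] A) :
    TensorProduct.map γ ε (multilinearTensor K k φ ψ z) =
      multilinearTensor K k φ' ψ' fun i => TensorProduct.map α β (z i) := by
  have : (TensorProduct.map γ ε).compMultilinearMap (multilinearTensor K k φ ψ) =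
      (multilinearTensor K k φ' ψ').compLinearMap fun _ => TensorProduct.map α β := by
    refine multilinear_ext_tmul K fun x a => ?_
    simp only [LinearMap.compMultilinearMap_apply, MultilinearMap.compLinearMap_apply,
      TensorProduct.map_tmul, multilinearTensor_tmul, h, h']
  exact DFunLike.congr_fun this z

end TensorMultilinear

/-! ### Maurer-Cartan forms -/

/-- For an involution `τ`, the projection onto the even (`ε = 0`) or odd (`ε = 1`) part. -/
def parityProj {K : Type u} [Field K] {M : Type u} [AddCommGroup M] [Module K M]
    (τ : M →ₗ[K] M) (ε : Fin 2) : M →ₗ[K] M :=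
  (2 : K)⁻¹ • (LinearMap.id + (-1 : K) ^ (ε : ℕ) • τ)

namespace LInfinityAlgebra

open PolyForm

variable {K : Type u} [Field K]

/-- The operations `[α₁, …, αₖ]`, `k ≠ 1`, on `g ⊗ Ωₙ`: on homogeneous elements,
`[x₁ ⊗ a₁, …, xₖ ⊗ aₖ] = (-1)^{∑_{i < j} |aᵢ| |xⱼ|} [x₁, …, xₖ] ⊗ a₁ ⋯ aₖ`
(see `bracketForms_tmul`). The sum below runs over the parities `p` of the `xⱼ` and `q` of
the `aᵢ`. -/
def bracketForms (g : LInfinityAlgebra K) (n k : ℕ) :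
    MultilinearMap K (fun _ : Fin k => g.carrier ⊗[K] Forms K n) (g.carrier ⊗[K] Forms K n) :=
  ∑ p : Fin k → Fin 2, ∑ q : Fin k → Fin 2,
    (∏ i, ∏ j ∈ Finset.Ioi i, (-1 : K) ^ ((q i : ℕ) * (p j : ℕ))) •
      multilinearTensor K k
        ((g.bracket k).compLinearMap fun j => parityProj g.parity (p j))
        ((MultilinearMap.mkPiAlgebraFin K k (Forms K n)).compLinearMap fun i =>
          parityProj (formParity K n).toLinearMap (q i))

/-- The differential `x ⊗ a ↦ δx ⊗ a + (-1)^{|x|} x ⊗ da` (that is, `d + δ`) of `g ⊗ Ωₙ`. -/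
def totalDiff (g : LInfinityAlgebra K) (n : ℕ) :
    g.carrier ⊗[K] Forms K n →ₗ[K] g.carrier ⊗[K] Forms K n :=
  TensorProduct.map g.delta LinearMap.id + TensorProduct.map g.parity (d K n)

/-- The elements of `g ⊗ Ωₙ` of total degree `i`: the sum of the `g^{i-p} ⊗ Ωₙᵖ`. -/
def totalDegree (g : LInfinityAlgebra K) (n : ℕ) (i : ℤ) :
    Submodule K (g.carrier ⊗[K] Forms K n) :=
  ⨆ p : ℕ, LinearMap.range (TensorProduct.map (g.gr (i - p)).subtype (degreePart K n p).subtype)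

/-- The curvature `(d + δ) α + ∑_{ℓ ≥ 2} [α, …, α] / ℓ!`, for nilpotent `g`, so that the sum is
finite. -/
def curvature (g : LInfinityAlgebra K) (n : ℕ) (α : g.carrier ⊗[K] Forms K n) :
    g.carrier ⊗[K] Forms K n :=
  g.totalDiff n α +
    ∑ᶠ l : ℕ, ((l + 2).factorial : K)⁻¹ • g.bracketForms n (l + 2) fun _ => α

/-- The Maurer-Cartan elements of `g ⊗ Ωₙ`, for nilpotent `g`. -/
def maurerCartan (g : LInfinityAlgebra K) (n : ℕ) : Set (g.carrier ⊗[K] Forms K n) :=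
  {α | α ∈ g.totalDegree n 1 ∧ g.curvature n α = 0}

/-! Functoriality in `g` and in the simplex. -/

/-- The map `g ⊗ Ωₙ → h ⊗ Ωₘ` induced by a morphism `g → h` and a map of vertices. -/
def formsMap {g h : LInfinityAlgebra K} (φ : g ⟶ h) {m n : ℕ} (f : Fin (m + 1) → Fin (n + 1)) :
    g.carrier ⊗[K] Forms K n →ₗ[K] h.carrier ⊗[K] Forms K m :=
  TensorProduct.map (Hom.toLin φ) (pullback K f).toLinearMap

lemma formsMap_id (g : LInfinityAlgebra K) (n : ℕ) (α : g.carrier ⊗[K] Forms K n) :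
    formsMap (𝟙 g) (id : Fin (n + 1) → Fin (n + 1)) α = α := by
  rw [formsMap, pullback_id]
  exact DFunLike.congr_fun (TensorProduct.map_id (R := K)) α

lemma formsMap_comp {g₁ g₂ g₃ : LInfinityAlgebra K} (φ : g₁ ⟶ g₂) (ψ : g₂ ⟶ g₃) {l m n : ℕ}
    (f : Fin (m + 1) → Fin (n + 1)) (f' : Fin (l + 1) → Fin (m + 1))
    (α : g₁.carrier ⊗[K] Forms K n) :
    formsMap (φ ≫ ψ) (f ∘ f') α = formsMap ψ f' (formsMap φ f α) := by
  rw [formsMap, pullback_comp]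
  exact (TensorProduct.map_map (Hom.toLin ψ) (pullback K f').toLinearMap (Hom.toLin φ)
    (pullback K f).toLinearMap α).symm

lemma map_parityProj {M N : Type u} [AddCommGroup M] [Module K M] [AddCommGroup N] [Module K N]
    {τ : M →ₗ[K] M} {τ' : N →ₗ[K] N} (L : M →ₗ[K] N) (h : ∀ x, L (τ x) = τ' (L x)) (ε : Fin 2)
    (x : M) : L (parityProj τ ε x) = parityProj τ' ε (L x) := by
  simp [parityProj, h]

lemma formsMap_bracketForms {g h : LInfinityAlgebra K} (φ : g ⟶ h) {m n : ℕ}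
    (f : Fin (m + 1) → Fin (n + 1)) (k : ℕ) (α : Fin k → g.carrier ⊗[K] Forms K n) :
    formsMap φ f (g.bracketForms n k α) = h.bracketForms m k fun i => formsMap φ f (α i) := by
  simp only [bracketForms, sum_apply, smul_apply, map_sum, map_smul]
  refine Finset.sum_congr rfl fun p _ => Finset.sum_congr rfl fun q _ => ?_
  congr 1
  refine multilinearTensor_natural K _ _ _ _ (fun x => ?_) (fun a => ?_) α
  · simp only [MultilinearMap.compLinearMap_apply]
    rw [Hom.map_bracket]
    congr 1
    funext i
    exact map_parityProj _ (map_parity φ) _ _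
  · simp only [MultilinearMap.compLinearMap_apply, MultilinearMap.mkPiAlgebraFin_apply]
    rw [AlgHom.toLinearMap_apply, map_list_prod, List.map_ofFn]
    congr 2
    funext i
    exact map_parityProj (pullback K f).toLinearMap (pullback_formParity K f) _ _

lemma formsMap_totalDiff {g h : LInfinityAlgebra K} (φ : g ⟶ h) {m n : ℕ}
    (f : Fin (m + 1) → Fin (n + 1)) (α : g.carrier ⊗[K] Forms K n) :
    formsMap φ f (g.totalDiff n α) = h.totalDiff m (formsMap φ f α) := by
  induction α using TensorProduct.induction_on with
  | zero => simp only [map_zero]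
  | add x y hx hy => simp only [map_add, hx, hy]
  | tmul x a =>
    simp only [formsMap, totalDiff, LinearMap.add_apply, TensorProduct.map_tmul, map_add,
      LinearMap.id_apply, AlgHom.toLinearMap_apply, map_delta, map_parity, pullback_d]

lemma formsMap_mem_totalDegree {g h : LInfinityAlgebra K} (φ : g ⟶ h) {m n : ℕ}
    (f : Fin (m + 1) → Fin (n + 1)) {i : ℤ} {α : g.carrier ⊗[K] Forms K n}
    (hα : α ∈ g.totalDegree n i) : formsMap φ f α ∈ h.totalDegree m i := by
  refine Submodule.iSup_induction _ (motive := fun α => formsMap φ f α ∈ h.totalDegree m i) hα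
    ?_ ?_ ?_
  · rintro p _ ⟨z, rfl⟩
    refine Submodule.mem_iSup_of_mem p ?_
    induction z using TensorProduct.induction_on with
    | zero =>
      rw [map_zero, map_zero]
      exact zero_mem _
    | add x y hx hy =>
      rw [map_add, map_add]
      exact add_mem hx hy
    | tmul x a =>
      exact ⟨⟨_, Hom.map_gr φ _ _ x.2⟩ ⊗ₜ ⟨_, pullback_mem_degreePart K f a.2⟩, rfl⟩
  · rw [map_zero]
    exact zero_mem _
  · intro x y hx hy
    rw [map_add]
    exact add_mem hx hy

lemma finite_curvature {g : LInfinityAlgebra K} (hg : g.IsNilpotent) (n : ℕ)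
    (α : g.carrier ⊗[K] Forms K n) :
    (Function.support fun l : ℕ =>
      ((l + 2).factorial : K)⁻¹ • g.bracketForms n (l + 2) fun _ => α).Finite := by
  obtain ⟨N, hN⟩ := hg.bracket_eq_zero
  refine (Set.finite_lt_nat N).subset fun l hl => ?_
  by_contra hlN
  refine hl ?_
  have h0 : g.bracket (l + 2) = 0 := hN _ (by simp at hlN; omega)
  have hz : ∀ p : Fin (l + 2) → Fin 2,
      (g.bracket (l + 2)).compLinearMap (fun j => parityProj g.parity (p j)) = 0 := by
    intro p
    rw [h0]
    rfl
  have : g.bracketForms n (l + 2) = 0 := by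
    rw [bracketForms]
    simp only [hz, map_zero, LinearMap.zero_apply, smul_zero, Finset.sum_const_zero]
  simp only [this, zero_apply, smul_zero]

lemma formsMap_curvature {g h : LInfinityAlgebra K} (hg : g.IsNilpotent) (φ : g ⟶ h) {m n : ℕ}
    (f : Fin (m + 1) → Fin (n + 1)) (α : g.carrier ⊗[K] Forms K n) :
    formsMap φ f (g.curvature n α) = h.curvature m (formsMap φ f α) := by
  rw [curvature, curvature, map_add, formsMap_totalDiff]
  congr 1
  refine ((formsMap φ f).toAddMonoidHom.map_finsum (finite_curvature hg n α)).trans ?_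
  refine finsum_congr fun l => ?_
  rw [LinearMap.toAddMonoidHom_coe, map_smul, formsMap_bracketForms]

lemma formsMap_mem_maurerCartan {g h : LInfinityAlgebra K} (hg : g.IsNilpotent) (φ : g ⟶ h)
    {m n : ℕ} (f : Fin (m + 1) → Fin (n + 1)) {α : g.carrier ⊗[K] Forms K n}
    (hα : α ∈ g.maurerCartan n) : formsMap φ f α ∈ h.maurerCartan m :=
  ⟨formsMap_mem_totalDegree φ f hα.1, by rw [← formsMap_curvature hg, hα.2, map_zero]⟩

/-! The defining formula of the brackets on homogeneous elements. -/

lemma parityProj_of_eq {K : Type u} [Field K] [CharZero K] {M : Type u} [AddCommGroup M]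
    [Module K M] {τ : M →ₗ[K] M} {δ : Fin 2} {x : M} (h : τ x = (-1 : K) ^ (δ : ℕ) • x)
    (ε : Fin 2) : parityProj τ ε x = if ε = δ then x else 0 := by
  rw [parityProj, LinearMap.smul_apply, LinearMap.add_apply, LinearMap.smul_apply, h,
    LinearMap.id_apply]
  fin_cases ε <;> fin_cases δ <;>
    simp [← two_smul K x, smul_smul]

lemma formParity_of_mem {K : Type u} [Field K] {n p : ℕ} {a : Forms K n}
    (ha : a ∈ degreePart K n p) : formParity K n a = (-1 : K) ^ p • a := by
  obtain ⟨z, rfl⟩ := ha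
  induction z using TensorProduct.induction_on with
  | zero => simp only [map_zero, smul_zero]
  | add x y hx hy => rw [map_add, map_add, hx, hy, smul_add]
  | tmul r w =>
    have hw : ExteriorAlgebra.map (-LinearMap.id) (w : ExteriorAlgebra K (Cotangent K n)) =
        (-1 : K) ^ p • (w : ExteriorAlgebra K (Cotangent K n)) := by
      obtain ⟨w, hw⟩ := w
      change ExteriorAlgebra.map (-LinearMap.id) w = (-1 : K) ^ p • w
      rw [← ExteriorAlgebra.ιMulti_span_fixedDegree] at hw
      refine Submodule.span_induction (p := fun w _ => ExteriorAlgebra.map (-LinearMap.id) w =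
        (-1 : K) ^ p • w) ?_ ?_ ?_ ?_ hw
      · rintro _ ⟨v, rfl⟩
        have := (ExteriorAlgebra.ιMulti K p).map_smul_univ (fun _ => (-1 : K)) v
        rw [ExteriorAlgebra.map_apply_ιMulti]
        simp only [Finset.prod_const, Finset.card_univ, Fintype.card_fin] at this
        rw [← this]
        congr 1
        funext i
        simp
      · rw [map_zero, smul_zero]
      · intro a b _ _ ha hb
        rw [map_add, ha, hb, smul_add]
      · intro c b _ hb
        rw [map_smul, hb, smul_comm]
    rw [TensorProduct.map_tmul, formParity, Algebra.TensorProduct.map_tmul,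
      ← TensorProduct.tmul_smul]
    exact congrArg _ hw

lemma negOnePow_eq_emod (i : ℤ) :
    ((i.negOnePow : ℤ) : K) = (-1 : K) ^ (i % 2).toNat := by
  rcases Int.even_or_odd i with h | h
  · rw [Int.negOnePow_even i h, Int.even_iff.1 h]
    simp
  · rw [Int.negOnePow_odd i h, Int.odd_iff.1 h]
    simp

lemma bracketForms_tmul [CharZero K] (g : LInfinityAlgebra K) (n k : ℕ) (deg : Fin k → ℤ)
    (e : Fin k → ℕ) (x : Fin k → g.carrier) (a : Fin k → Forms K n)
    (hx : ∀ i, x i ∈ g.gr (deg i)) (ha : ∀ i, a i ∈ degreePart K n (e i)) :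
    g.bracketForms n k (fun i => x i ⊗ₜ a i) =
      (∏ i, ∏ j ∈ Finset.Ioi i, (((e i * deg j : ℤ).negOnePow : ℤ) : K)) •
        (g.bracket k x ⊗ₜ[K] (List.ofFn a).prod) := by
  let p₀ : Fin k → Fin 2 := fun j => ⟨(deg j % 2).toNat, by omega⟩
  let q₀ : Fin k → Fin 2 := fun i => ⟨e i % 2, by omega⟩
  have hp : ∀ (p : Fin k → Fin 2) j, parityProj g.parity (p j) (x j) =
      if p j = p₀ j then x j else 0 := fun p j =>
    parityProj_of_eq (by rw [g.parity_of_mem (hx j), negOnePow_eq_emod]) _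
  have hq : ∀ (q : Fin k → Fin 2) i, parityProj (formParity K n).toLinearMap (q i) (a i) =
      if q i = q₀ i then a i else 0 := fun q i =>
    parityProj_of_eq (by
      rw [AlgHom.toLinearMap_apply, formParity_of_mem (ha i)]
      congr 1
      exact (neg_one_pow_eq_pow_mod_two (R := K) (e i))) _
  simp only [bracketForms, sum_apply, smul_apply, multilinearTensor_tmul,
    MultilinearMap.compLinearMap_apply, hp, hq]
  rw [Finset.sum_eq_single p₀, Finset.sum_eq_single q₀]
  · simp only [if_true, MultilinearMap.mkPiAlgebraFin_apply]
    congr 1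
    refine Finset.prod_congr rfl fun i _ => Finset.prod_congr rfl fun j _ => ?_
    have h1 : (-1 : K) ^ (q₀ i : ℕ) = (-1) ^ e i := (neg_one_pow_eq_pow_mod_two (R := K) (e i)).symm
    have h2 : (((deg j).negOnePow : ℤ) : K) = (-1) ^ (p₀ j : ℕ) := negOnePow_eq_emod (deg j)
    rw [pow_mul, h1, ← pow_mul, mul_comm (e i), pow_mul, ← h2, mul_comm (e i : ℤ)]
    rcases Int.even_or_odd (deg j) with h | h
    · rw [Int.negOnePow_even _ h, Int.negOnePow_even _ (h.mul_right _)]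
      simp
    · rw [Int.negOnePow_odd _ h]
      rcases Nat.even_or_odd (e i) with h' | h'
      · rw [Int.negOnePow_even _ (((Int.even_coe_nat _).2 h').mul_left _)]
        simp [h'.neg_one_pow]
      · rw [Int.negOnePow_odd _ (h.mul ((Int.odd_coe_nat _).2 h'))]
        simp [h'.neg_one_pow]
  · intro q _ hne
    obtain ⟨i, hi⟩ := Function.ne_iff.1 hne
    rw [(MultilinearMap.mkPiAlgebraFin K k (Forms K n)).map_coord_zero i (if_neg hi),
      TensorProduct.tmul_zero, smul_zero]
  · simp
  · intro p _ hne
    obtain ⟨i, hi⟩ := Function.ne_iff.1 hne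
    refine Finset.sum_eq_zero fun q _ => ?_
    rw [(g.bracket k).map_coord_zero i (if_neg hi), TensorProduct.zero_tmul, smul_zero]
  · simp

/-! ### The simplicial sets `MC•(g)` and `γ•(g)` -/

variable (K) in
/-- The category of nilpotent `L∞`-algebras. -/
abbrev Nilpotent : Type (u + 1) :=
  ObjectProperty.FullSubcategory (fun g : LInfinityAlgebra K => g.IsNilpotent)

variable (K) in
/-- The category of abelian `L∞`-algebras. -/
abbrev Abelian : Type (u + 1) :=
  ObjectProperty.FullSubcategory (fun g : LInfinityAlgebra K => g.IsAbelian)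

variable (K) in
/-- Abelian `L∞`-algebras are nilpotent. -/
def abelianToNilpotent : Abelian K ⥤ Nilpotent K :=
  ObjectProperty.ιOfLE fun _ hg => IsAbelian.isNilpotent hg

/-- The simplicial set `MC•(g)`, whose `n`-simplices are the Maurer-Cartan elements
of `g ⊗ Ωₙ`. -/
def MC (g : Nilpotent K) : SSet.{u} where
  obj n := g.obj.maurerCartan n.unop.len
  map f := TypeCat.ofHom fun α =>
    ⟨formsMap (𝟙 g.obj) f.unop.toOrderHom α.1, formsMap_mem_maurerCartan g.property _ _ α.2⟩
  map_id n := by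
    ext α
    exact formsMap_id g.obj _ α.1
  map_comp f f' := by
    ext α
    have := formsMap_comp (𝟙 g.obj) (𝟙 g.obj) f.unop.toOrderHom f'.unop.toOrderHom α.1
    rw [Category.comp_id] at this
    exact this

variable [CharZero K]

/-- The action `x ⊗ a ↦ (-1)^{|x|} x ⊗ s a` of a gauge on `g ⊗ Ωₙ`. -/
def gaugeAction (s : Gauge K) (g : LInfinityAlgebra K) (n : ℕ) :
    g.carrier ⊗[K] Forms K n →ₗ[K] g.carrier ⊗[K] Forms K n :=
  TensorProduct.map g.parity (s.s n)

lemma formsMap_gaugeAction (s : Gauge K) {g h : LInfinityAlgebra K} (φ : g ⟶ h) {m n : ℕ}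
    (f : Fin (m + 1) → Fin (n + 1)) (hf : Monotone f) (α : g.carrier ⊗[K] Forms K n) :
    formsMap φ f (gaugeAction s g n α) = gaugeAction s h m (formsMap φ f α) := by
  induction α using TensorProduct.induction_on with
  | zero => simp only [map_zero]
  | add x y hx hy => simp only [map_add, hx, hy]
  | tmul x a =>
    simp only [formsMap, gaugeAction, TensorProduct.map_tmul, AlgHom.toLinearMap_apply,
      map_parity, s.simplicial f hf]

/-- The simplicial subset `γ•(g) = {α ∈ MC•(g) | s• α = 0}` of `MC•(g)`. -/
def gammaSub (s : Gauge K) (g : Nilpotent K) : (MC g).Subcomplex where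
  obj n := {α | gaugeAction s g.obj n.unop.len α.1 = 0}
  map {m n} f α hα := by
    change gaugeAction s g.obj _ (formsMap (𝟙 g.obj) f.unop.toOrderHom α.1) = 0
    have hα' : gaugeAction s g.obj m.unop.len α.1 = 0 := hα
    rw [← formsMap_gaugeAction s _ _ f.unop.toOrderHom.monotone, hα', map_zero]

/-- The functor `γ•` from nilpotent `L∞`-algebras to simplicial sets. -/
def gamma (s : Gauge K) : Nilpotent K ⥤ SSet.{u} where
  obj g := (gammaSub s g).toSSet
  map {g h} φ :=
    { app := fun n => TypeCat.ofHom fun α =>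
        ⟨⟨formsMap φ.hom (id : Fin (n.unop.len + 1) → _) α.1.1,
          formsMap_mem_maurerCartan g.property _ _ α.1.2⟩, by
          change gaugeAction s h.obj _ (formsMap φ.hom id α.1.1) = 0
          have hα : gaugeAction s g.obj n.unop.len α.1.1 = 0 := α.2
          rw [← formsMap_gaugeAction s _ _ monotone_id, hα, map_zero]⟩
      naturality := fun m n f => by
        ext α
        refine Subtype.ext (Subtype.ext ?_)
        change formsMap φ.hom id (formsMap (𝟙 g.obj) f.unop.toOrderHom α.1.1) =
          formsMap (𝟙 h.obj) f.unop.toOrderHom (formsMap φ.hom id α.1.1)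
        rw [← formsMap_comp, ← formsMap_comp, Category.id_comp, Category.comp_id]
        rfl }
  map_id g := by
    ext n α
    exact Subtype.ext (Subtype.ext (formsMap_id g.obj _ α.1.1))
  map_comp {g₁ g₂ g₃} φ ψ := by
    ext n α
    exact Subtype.ext (Subtype.ext (formsMap_comp φ.hom ψ.hom id id α.1.1))

/-! ### The underlying cochain complex and the Dold-Kan functor -/

/-- The operation `δ : gⁱ → gⁱ⁺¹`. -/
def deltaHom {K : Type u} [Field K] (g : LInfinityAlgebra K) (i : ℤ) :
    ModuleCat.of K (g.gr i) ⟶ ModuleCat.of K (g.gr (i + 1)) :=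
  ModuleCat.ofHom (g.delta.restrict fun _ hx => g.delta_mem hx)

lemma deltaHom_comp {K : Type u} [Field K] (g : LInfinityAlgebra K) (i : ℤ) :
    g.deltaHom i ≫ g.deltaHom (i + 1) = 0 :=
  ModuleCat.hom_ext (LinearMap.ext fun x => Subtype.ext (g.delta_delta x.2))

/-- The cochain complex `(g, δ)` underlying an `L∞`-algebra. -/
def toCochainComplex (K : Type u) [Field K] :
    LInfinityAlgebra K ⥤ CochainComplex (ModuleCat.{u} K) ℤ where
  obj g := CochainComplex.of (fun i => ModuleCat.of K (g.gr i)) g.deltaHom g.deltaHom_comp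
  map {g h} φ := CochainComplex.ofHom
    (fun i => ModuleCat.ofHom ((Hom.toLin φ).restrict fun x hx => Hom.map_gr φ i x hx))
    (fun i => by
      refine (congrArg (_ ≫ ·) (CochainComplex.of_d _ h.deltaHom i)).trans (Eq.trans ?_
        (congrArg (· ≫ _) (CochainComplex.of_d _ g.deltaHom i)).symm)
      exact ModuleCat.hom_ext (LinearMap.ext fun x => Subtype.ext (map_delta φ x.1).symm))
  map_id g := rfl
  map_comp φ ψ := rfl

end LInfinityAlgebra

/-- The Dold-Kan functor `K•(V)`: its `n`-simplices are the morphisms of complexes from the complex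
`C_*(Δⁿ)` of normalized simplicial chains with coefficients in `K`, regarded as a cochain complex
with `Cₖ` in degree `-k`, to `V`. -/
def doldKan (K : Type u) [Field K] : CochainComplex (ModuleCat.{u} K) ℤ ⥤ SSet.{u} :=
  yoneda ⋙ (Functor.whiskeringLeft _ _ _).obj
    (SSet.stdSimplex.{u} ⋙ SSet.normalizedChainComplexFunctorObj (ModuleCat.of K K) ⋙
      ComplexShape.embeddingDownNat.extendFunctor (ModuleCat.{u} K)).op

end

noncomputable section

namespace PolyForm

variable (K : Type u) [Field K]

/-! ### Generators of the forms -/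

/-! For abelian `g` the Maurer–Cartan equation is linear: it says Dα = 0, where D = d + δ. Let S be
the action of the gauge on g ⊗ Ωₙ. The homotopy id - P = ds + sd, and the fact that δ ⊗ 1
anticommutes with S, give α - Pα = DSα + SDα. So a closed α with Sα = 0 satisfies Pα = α
(`map_whitney_of_gaugeAction_eq_zero`). Conversely sP = 0 (`Gauge.s_whitney`), so the image of P
satisfies the gauge condition. Hence the n-simplices of γ(g) are the closed elements of degree 1 of
the form ∑ a_I ⊗ ω_I, for every choice of gauge.

The integrals I_J over the faces are dual to the forms ω_I (`integral_elementary_self`,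
`integral_elementary_of_ne`), so the a_I are arbitrary elements of degree 1 - |I|, where |I| is the
dimension of the face. Since P commutes with d (`Gauge.whitney_d`), Dα is again in the image of P
and vanishes as soon as its integrals do. By Stokes for elementary forms (`integral_d_elementary`)
this reads δ a_J + (-1)^{k+1} ∑_b (-1)^b a_{∂_b J} = 0 for every face J of dimension k + 1, and δ
a_J = 0 for every vertex J. After rescaling by the signs (-1)^{k(k+1)/2} these are the equations of
a morphism of complexes from the normalized chains of Δⁿ to g[1], whose differential is -δ.

The bijection is recorded as the relation `Corresponds`: the value of the chain map at each simplex
is the signed integral of α over it. Pulling back forms or applying a morphism of algebras preserves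
this relation (`Corresponds.map`), and a chain map is determined by its values, so both naturality
statements follow. -/

lemma forms_induction {n : ℕ} {p : Forms K n → Prop} (h0 : p 0)
    (hadd : ∀ x y, p x → p y → p (x + y))
    (h : ∀ (r : Coord K n) (k : ℕ) (v : Fin k → Cotangent K n),
      p (r ⊗ₜ ExteriorAlgebra.ιMulti K k v)) (x : Forms K n) : p x := by
  induction x using TensorProduct.induction_on with
  | zero => exact h0
  | add x y hx hy => exact hadd x y hx hy
  | tmul r w =>
    have hw : w ∈ Submodule.span K (Set.range fun x : Σ k, (Fin k → Cotangent K n) =>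
        ExteriorAlgebra.ιMulti K x.1 x.2) := by
      rw [ExteriorAlgebra.ιMulti_span]
      trivial
    -- Quantifying over `r` lets a scalar on the exterior factor be absorbed into `r`, so that no
    -- closure of `p` under scalars is needed.
    refine Submodule.span_induction (p := fun w _ => ∀ r : Coord K n, p (r ⊗ₜ w))
      ?_ ?_ ?_ ?_ hw r
    · rintro _ ⟨⟨k, v⟩, rfl⟩ r
      exact h r k v
    · intro r
      rwa [TensorProduct.tmul_zero]
    · intro a b _ _ ha hb r
      rw [TensorProduct.tmul_add]
      exact hadd _ _ (ha r) (hb r)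
    · intro c b _ hb r
      rw [← TensorProduct.smul_tmul]
      exact hb _

lemma tmul_ιMulti_mem_degreePart {n k : ℕ} (r : Coord K n) (v : Fin k → Cotangent K n) :
    r ⊗ₜ ExteriorAlgebra.ιMulti K k v ∈ degreePart K n k := by
  have hv : ExteriorAlgebra.ιMulti K k v ∈ ⋀[K]^k (Cotangent K n) := by
    rw [← ExteriorAlgebra.ιMulti_span_fixedDegree]
    exact Submodule.subset_span ⟨v, rfl⟩
  exact ⟨r ⊗ₜ ⟨_, hv⟩, rfl⟩

lemma degreePart_induction {n k : ℕ} {p : Forms K n → Prop} (h0 : p 0)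
    (hadd : ∀ x y, p x → p y → p (x + y))
    (h : ∀ (r : Coord K n) (v : Fin k → Cotangent K n), p (r ⊗ₜ ExteriorAlgebra.ιMulti K k v))
    {x : Forms K n} (hx : x ∈ degreePart K n k) : p x := by
  obtain ⟨z, rfl⟩ := hx
  induction z using TensorProduct.induction_on with
  | zero => rwa [map_zero]
  | add x y hx hy =>
    rw [map_add]
    exact hadd _ _ hx hy
  | tmul r w =>
    obtain ⟨w, hw⟩ := w
    change p (r ⊗ₜ w)
    rw [← ExteriorAlgebra.ιMulti_span_fixedDegree] at hw
    refine Submodule.span_induction (p := fun w _ => ∀ r : Coord K n, p (r ⊗ₜ w))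
      ?_ ?_ ?_ ?_ hw r
    · rintro _ ⟨v, rfl⟩ r
      exact h r v
    · intro r
      rwa [TensorProduct.tmul_zero]
    · intro a b _ _ ha hb r
      rw [TensorProduct.tmul_add]
      exact hadd _ _ (ha r) (hb r)
    · intro c b _ hb r
      rw [← TensorProduct.smul_tmul]
      exact hb _

lemma prod_dt {n k : ℕ} (i : Fin k → Fin (n + 1)) :
    (List.ofFn fun l => dt K (i l)).prod =
      (1 : Coord K n) ⊗ₜ[K] ExteriorAlgebra.ιMulti K k fun l => covec K (i l) := by
  have h := map_list_prod (Algebra.TensorProduct.includeRight :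
    ExteriorAlgebra K (Cotangent K n) →ₐ[K] Forms K n)
    (List.ofFn fun l => ExteriorAlgebra.ι K (covec K (i l)))
  rw [ExteriorAlgebra.ιMulti_apply]
  refine Eq.trans ?_ h.symm
  rw [List.map_ofFn]
  rfl

lemma elementary_eq {n k : ℕ} (i : Fin (k + 1) → Fin (n + 1)) :
    elementary K i = (k.factorial : K) • ∑ j : Fin (k + 1), (-1 : K) ^ (j : ℕ) •
      (coord K (i j) ⊗ₜ[K] ExteriorAlgebra.ιMulti K k fun l => covec K (i (j.succAbove l))) := by
  rw [elementary]
  congr 1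
  refine Finset.sum_congr rfl fun j _ => ?_
  rw [prod_dt K fun l => i (j.succAbove l), t, Algebra.TensorProduct.tmul_mul_tmul, mul_one,
    one_mul]

lemma elementary_mem_degreePart {n k : ℕ} (i : Fin (k + 1) → Fin (n + 1)) :
    elementary K i ∈ degreePart K n k := by
  rw [elementary_eq]
  exact Submodule.smul_mem _ _ (Submodule.sum_mem _ fun j _ => Submodule.smul_mem _ _
    (tmul_ιMulti_mem_degreePart K _ _))

/-! ### The differential -/

lemma d_tmul_ιMulti {n k : ℕ} (p : MvPolynomial (Fin (n + 1)) K) (v : Fin k → Cotangent K n) :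
    d K n (Coord.mk K n p ⊗ₜ ExteriorAlgebra.ιMulti K k v) =
      ∑ i, Coord.mk K n (MvPolynomial.pderiv i p) ⊗ₜ[K]
        ExteriorAlgebra.ιMulti K (k + 1) (Matrix.vecCons (covec K i) v) := by
  rw [d_tmul, diffCoord_mk, diffPoly_apply, Finset.sum_mul]
  refine Finset.sum_congr rfl fun i _ => ?_
  rw [Algebra.TensorProduct.tmul_mul_tmul, mul_one, ExteriorAlgebra.ιMulti_succ_apply]
  rfl

lemma d_mem_degreePart {n k : ℕ} {x : Forms K n} (hx : x ∈ degreePart K n k) :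
    d K n x ∈ degreePart K n (k + 1) := by
  refine degreePart_induction K (p := fun x => d K n x ∈ degreePart K n (k + 1)) ?_ ?_ ?_ hx
  · rw [map_zero]
    exact zero_mem _
  · intro x y hx hy
    rw [map_add]
    exact add_mem hx hy
  · intro r v
    obtain ⟨p, rfl⟩ := coord_surjective K n r
    rw [d_tmul_ιMulti]
    exact Submodule.sum_mem _ fun i _ => tmul_ιMulti_mem_degreePart K _ _

lemma ιMulti_vecCons_swap {n k : ℕ} (a b : Cotangent K n) (v : Fin k → Cotangent K n) :
    ExteriorAlgebra.ιMulti K (k + 2) (Matrix.vecCons a (Matrix.vecCons b v)) =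
      -ExteriorAlgebra.ιMulti K (k + 2) (Matrix.vecCons b (Matrix.vecCons a v)) := by
  rw [ExteriorAlgebra.ιMulti_succ_apply, ExteriorAlgebra.ιMulti_succ_apply,
    ExteriorAlgebra.ιMulti_succ_apply, ExteriorAlgebra.ιMulti_succ_apply]
  simp only [Matrix.vecTail, Function.comp_def, Matrix.cons_val_zero, Matrix.cons_val_succ]
  rw [← mul_assoc, ← mul_assoc, eq_neg_iff_add_eq_zero, ← add_mul,
    ExteriorAlgebra.ι_add_mul_swap, zero_mul]

lemma pderiv_comm {n : ℕ} (i j : Fin n) (p : MvPolynomial (Fin n) K) :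
    MvPolynomial.pderiv i (MvPolynomial.pderiv j p) =
      MvPolynomial.pderiv j (MvPolynomial.pderiv i p) := by
  have h : ⁅MvPolynomial.pderiv (R := K) i, MvPolynomial.pderiv (R := K) j⁆ = 0 := by
    refine MvPolynomial.derivation_ext fun l => ?_
    rw [Derivation.commutator_apply, MvPolynomial.pderiv_X, MvPolynomial.pderiv_X]
    by_cases h1 : i = l <;> by_cases h2 : j = l <;> simp [h1, h2]
  have := DFunLike.congr_fun h p
  rwa [Derivation.commutator_apply, Derivation.zero_apply, sub_eq_zero] at this

lemma d_d [CharZero K] {n : ℕ} (x : Forms K n) : d K n (d K n x) = 0 := by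
  refine forms_induction K (p := fun x => d K n (d K n x) = 0) ?_ ?_ ?_ x
  · simp only [map_zero]
  · intro x y hx hy
    rw [map_add, map_add, hx, hy, add_zero]
  · intro r k v
    obtain ⟨p, rfl⟩ := coord_surjective K n r
    rw [d_tmul_ιMulti, map_sum]
    simp only [d_tmul_ιMulti]
    set S := ∑ i, ∑ j, Coord.mk K n (MvPolynomial.pderiv j (MvPolynomial.pderiv i p)) ⊗ₜ[K]
      ExteriorAlgebra.ιMulti K (k + 2) (Matrix.vecCons (covec K j) (Matrix.vecCons (covec K i) v))
      with hS
    -- Second partial derivatives are symmetric and `dtⱼ dtᵢ` is antisymmetric; exchanging the two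
    -- summation indices changes the sign of `S`. Since 2 is invertible, `S` vanishes.
    have hneg : S = -S := by
      conv_lhs => rw [hS, Finset.sum_comm]
      rw [hS, ← Finset.sum_neg_distrib]
      refine Finset.sum_congr rfl fun i _ => ?_
      rw [← Finset.sum_neg_distrib]
      refine Finset.sum_congr rfl fun j _ => ?_
      rw [ιMulti_vecCons_swap, TensorProduct.tmul_neg, pderiv_comm]
    have h2 : (2 : K) • S = 0 := by
      rw [two_smul]
      exact eq_neg_iff_add_eq_zero.1 hneg
    exact (smul_eq_zero.1 h2).resolve_left two_ne_zero

/-- Each of the `k + 1` summands contributes the same form: the sign `(-1)ʲ` is exactly what it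
costs to move `dt_{iⱼ}` from the front to its place. This turns `k!` into `(k + 1)!`. -/
lemma d_elementary {n k : ℕ} (i : Fin (k + 1) → Fin (n + 1)) :
    d K n (elementary K i) = ((k + 1).factorial : K) •
      ((1 : Coord K n) ⊗ₜ[K] ExteriorAlgebra.ιMulti K (k + 1) fun l => covec K (i l)) := by
  have h : ∀ j : Fin (k + 1), d K n ((-1 : K) ^ (j : ℕ) • (coord K (i j) ⊗ₜ[K]
      ExteriorAlgebra.ιMulti K k fun l => covec K (i (j.succAbove l)))) =
      (1 : Coord K n) ⊗ₜ[K] ExteriorAlgebra.ιMulti K (k + 1) fun l => covec K (i l) := by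
    intro j
    have h1 := (ExteriorAlgebra.ιMulti K (k + 1)).map_insertNth j
      (covec K (i j)) fun l => covec K (i (j.succAbove l))
    have h2 := Fin.insertNth_self_removeNth (α := fun _ => Cotangent K n) j fun l => covec K (i l)
    rw [show (fun l => covec K (i (j.succAbove l))) = j.removeNth fun l => covec K (i l) from rfl,
      h2] at h1
    rw [map_smul, coord, d_tmul_ιMulti, Finset.sum_eq_single (i j), MvPolynomial.pderiv_X_self,
      map_one, ← TensorProduct.tmul_smul, h1]
    · refine congrArg ((1 : Coord K n) ⊗ₜ[K] ·) ?_
      -- The two sides carry `(-1)ʲ` as scalars of different types; the parity of `j` identifies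
      -- them.
      rcases Nat.even_or_odd (j : ℕ) with hj | hj
      · rw [hj.neg_one_pow, hj.neg_one_pow, one_smul, one_smul]
        rfl
      · rw [hj.neg_one_pow, hj.neg_one_pow, neg_one_smul, neg_one_smul]
        rfl
    · intro b _ hb
      rw [MvPolynomial.pderiv_X_of_ne hb.symm, map_zero, TensorProduct.zero_tmul]
    · simp
  rw [elementary_eq, map_smul, map_sum]
  simp only [h, Finset.sum_const, Finset.card_univ, Fintype.card_fin]
  rw [← Nat.cast_smul_eq_nsmul K, smul_smul, Nat.factorial_succ, Nat.cast_mul, mul_comm]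

/-! ### Integrals -/

lemma topCoeff_ιMulti {k : ℕ} (v : Fin k → Cotangent K k) :
    topCoeff K k (ExteriorAlgebra.ιMulti K k v) =
      (Matrix.of fun l b => edgePairing K k (v l) b).det := by
  rw [topCoeff, ExteriorAlgebra.liftAlternating_apply_ιMulti, Pi.single_eq_same]
  rfl

lemma topCoeff_ιMulti_of_ne {k p : ℕ} (h : p ≠ k) (v : Fin p → Cotangent K k) :
    topCoeff K k (ExteriorAlgebra.ιMulti K p v) = 0 := by
  rw [topCoeff, ExteriorAlgebra.liftAlternating_apply_ιMulti, Pi.single_eq_of_ne h]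
  rfl

lemma edgePairing_covec {k : ℕ} (i : Fin (k + 1)) (b : Fin k) :
    edgePairing K k (covec K i) b =
      (if b.succ = i then 1 else 0) - (if 0 = i then 1 else 0) := by
  rw [covec, edgePairing_mk, Pi.single_apply, Pi.single_apply]

/-- For `j > 0` the form contains `dt₀ = -(dt₁ + ⋯ + dtₖ)`, of which only the term `-dtⱼ` survives;
moving it into place gives the sign. In the matrix, `dt₀` is a first row of entries `-1`, along
which the determinant is expanded. -/
lemma topCoeff_face {k : ℕ} (j : Fin (k + 1)) :
    topCoeff K k (ExteriorAlgebra.ιMulti K k fun l => covec K (j.succAbove l)) =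
      (-1) ^ (j : ℕ) := by
  rw [topCoeff_ιMulti]
  simp only [edgePairing_covec]
  induction j using Fin.cases with
  | zero =>
    rw [Fin.val_zero, pow_zero, ← Matrix.det_one (n := Fin k)]
    congr 1
    ext l b
    simp [Matrix.one_apply, (Fin.succ_ne_zero _).symm, eq_comm]
  | succ i =>
    obtain ⟨k, rfl⟩ : ∃ m, k = m + 1 := ⟨k - 1, by have := i.2; omega⟩
    rw [Matrix.det_succ_row_zero, Finset.sum_eq_single i]
    · have h1 : ((Matrix.of fun l b : Fin (k + 1) =>
          (if b.succ = i.succ.succAbove l then (1 : K) else 0) -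
            if 0 = i.succ.succAbove l then 1 else 0).submatrix Fin.succ i.succAbove) = 1 := by
        ext l b
        simp [Matrix.one_apply, Fin.succ_succAbove_succ, eq_comm]
      rw [h1, Matrix.det_one]
      simp [pow_succ, Fin.succ_ne_zero]
    -- A minor that keeps the column of the edge from `e₀` to `e_{i+1}` has a zero column: neither
    -- `dt₀` nor `dt_{i+1}` is among its rows.
    · intro b _ hb
      obtain ⟨c, hc⟩ := Fin.exists_succAbove_eq (Ne.symm hb)
      rw [Matrix.det_eq_zero_of_column_eq_zero c, mul_zero]
      intro l
      simp [Fin.succ_succAbove_succ, (Fin.succ_ne_zero _).symm, hc, (Fin.succAbove_ne _ _).symm]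
    · simp

variable {K} in
lemma pullbackCovec_apply {n k : ℕ} {i : Fin (k + 1) → Fin (n + 1)} (hi : Function.Injective i)
    (a : Fin (k + 1)) : pullbackCovec K i (covec K (i a)) = covec K a := by
  rw [pullbackCovec_covec]
  simp [hi.eq_iff, Finset.filter_eq']

variable {K} in
lemma pullbackCoord_apply {n k : ℕ} {i : Fin (k + 1) → Fin (n + 1)} (hi : Function.Injective i)
    (a : Fin (k + 1)) : pullbackCoord K i (coord K (i a)) = coord K a := by
  rw [pullbackCoord_coord]
  simp [hi.eq_iff, Finset.filter_eq']

lemma pullbackCovec_eq_zero {n k : ℕ} {i : Fin (k + 1) → Fin (n + 1)} {a : Fin (n + 1)}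
    (ha : ∀ b, i b ≠ a) : pullbackCovec K i (covec K a) = 0 := by
  rw [pullbackCovec_covec]
  simp [ha]

lemma pullbackCoord_eq_zero {n k : ℕ} {i : Fin (k + 1) → Fin (n + 1)} {a : Fin (n + 1)}
    (ha : ∀ b, i b ≠ a) : pullbackCoord K i (coord K a) = 0 := by
  rw [pullbackCoord_coord]
  simp [ha]

/-! ### Increasing index tuples, and vanishing above the top degree -/

lemma strictMono_eq_of_range {n k : ℕ} {i j : Fin k → Fin n} (hi : StrictMono i)
    (hj : StrictMono j) (h : ∀ a, ∃ b, j b = i a) : i = j := by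
  have hr : Finset.univ.image i = Finset.univ.image j := by
    refine Finset.eq_of_subset_of_card_le ?_ ?_
    · intro x hx
      obtain ⟨a, -, rfl⟩ := Finset.mem_image.1 hx
      obtain ⟨b, hb⟩ := h a
      exact Finset.mem_image.2 ⟨b, Finset.mem_univ _, hb⟩
    · rw [Finset.card_image_of_injective _ hi.injective,
        Finset.card_image_of_injective _ hj.injective]
  refine (StrictMono.range_inj hi hj).1 ?_
  simpa using congrArg (fun s : Finset (Fin n) => (s : Set (Fin n))) hr

lemma strictMono_lt {n k : ℕ} {i : Fin (k + 1) → Fin (n + 1)} (hi : StrictMono i) : k < n + 1 := by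
  simpa using Fintype.card_le_of_injective i hi.injective

lemma edgePairing_injective (k : ℕ) : Function.Injective (edgePairing K k) := by
  rw [← LinearMap.ker_eq_bot, LinearMap.ker_eq_bot']
  intro x hx
  obtain ⟨v, rfl⟩ := Submodule.Quotient.mk_surjective _ x
  refine (Submodule.Quotient.mk_eq_zero _).2 (Submodule.mem_span_singleton.2 ⟨v 0, ?_⟩)
  funext b
  induction b using Fin.cases with
  | zero => simp
  | succ b =>
    have : v b.succ - v 0 = 0 := congrFun hx b
    simp [sub_eq_zero.1 this]

/-- The pairing with the edges embeds the cotangent space in `Kᵏ`, so more than `k` covectors are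
linearly dependent. -/
lemma ιMulti_eq_zero {k p : ℕ} (h : k < p) (v : Fin p → Cotangent K k) :
    ExteriorAlgebra.ιMulti K p v = 0 := by
  refine (ExteriorAlgebra.ιMulti K p).map_linearDependent v fun hv => ?_
  have := (hv.map' (edgePairing K k)
    (LinearMap.ker_eq_bot.2 (edgePairing_injective K k))).fintype_card_le_finrank
  simp at this
  omega

section CharZero

variable [CharZero K]

lemma integralTop_tmul {k : ℕ} (r : Coord K k) (w : ExteriorAlgebra K (Cotangent K k)) :
    integralTop K k (r ⊗ₜ w) = dirichlet K k r * topCoeff K k w := rfl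

lemma dirichlet_one (k : ℕ) : dirichlet K k 1 = ((k.factorial : K))⁻¹ := by
  have h := dirichletPoly_monomial K (0 : Fin (k + 1) →₀ ℕ)
  have h1 : (1 : Coord K k) = Coord.mk K k (MvPolynomial.monomial 0 1) := (map_one _).symm
  rw [h1, dirichlet, liftCoord_mk, h]
  simp

lemma integral_tmul_ιMulti {n k p : ℕ} (i : Fin (k + 1) → Fin (n + 1)) (r : Coord K n)
    (v : Fin p → Cotangent K n) :
    integral K i (r ⊗ₜ ExteriorAlgebra.ιMulti K p v) = dirichlet K k (pullbackCoord K i r) *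
      topCoeff K k (ExteriorAlgebra.ιMulti K p fun l => pullbackCovec K i (v l)) := by
  rw [integral, LinearMap.comp_apply, AlgHom.toLinearMap_apply, pullback_tmul, integralTop_tmul,
    ExteriorAlgebra.map_apply_ιMulti]
  rfl

lemma integral_eq_zero_of_mem {n k p : ℕ} (i : Fin (k + 1) → Fin (n + 1)) (h : p ≠ k)
    {x : Forms K n} (hx : x ∈ degreePart K n p) : integral K i x = 0 := by
  refine degreePart_induction K (p := fun x => integral K i x = 0) ?_ ?_ ?_ hx
  · rw [map_zero]
  · intro x y hx hy
    rw [map_add, hx, hy, add_zero]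
  · intro r v
    rw [integral_tmul_ιMulti, topCoeff_ιMulti_of_ne K h, mul_zero]

/-- A repeated vertex collapses an edge from `e₀` or makes two such edges coincide, so the
determinant has a zero column or two equal columns. This is what makes integration descend to
normalized chains. -/
lemma integral_of_not_injective {n k : ℕ} (i : Fin (k + 1) → Fin (n + 1))
    (h : ¬ Function.Injective i) (x : Forms K n) : integral K i x = 0 := by
  refine forms_induction K (p := fun x => integral K i x = 0) ?_ ?_ ?_ x
  · rw [map_zero]
  · intro x y hx hy
    rw [map_add, hx, hy, add_zero]
  · intro r p v
    rw [integral_tmul_ιMulti]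
    by_cases hp : p = k
    · subst hp
      choose w hw using fun l => Submodule.Quotient.mk_surjective _ (v l)
      have he : ∀ l b, edgePairing K p (pullbackCovec K i (v l)) b =
          w l (i b.succ) - w l (i 0) := by
        intro l b
        rw [← hw l]
        rfl
      rw [topCoeff_ιMulti]
      obtain ⟨a, b, hab, hne⟩ := by simpa only [Function.Injective, not_forall] using h
      have hzero : ∀ b, i 0 = i (Fin.succ b) → (Matrix.of fun l b =>
          edgePairing K p (pullbackCovec K i (v l)) b).det = 0 := fun b hb =>
        Matrix.det_eq_zero_of_column_eq_zero b fun l => by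
          rw [Matrix.of_apply, he, hb, sub_self]
      suffices (Matrix.of fun l b => edgePairing K p (pullbackCovec K i (v l)) b).det = 0 by
        rw [this, mul_zero]
      induction a using Fin.cases with
      | zero =>
        obtain ⟨b, rfl⟩ := Fin.exists_succ_eq.2 (Ne.symm hne)
        exact hzero b hab
      | succ a =>
        induction b using Fin.cases with
        | zero => exact hzero a hab.symm
        | succ b =>
          refine Matrix.det_zero_of_column_eq (fun h => hne (congrArg Fin.succ h)) fun l => ?_
          rw [Matrix.of_apply, Matrix.of_apply, he, he, hab]
    · rw [topCoeff_ιMulti_of_ne K hp, mul_zero]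

/-! ### Duality of integrals and elementary forms, and Stokes' formula -/

/-- The signs cancel and leave `k! ∑ⱼ ∫ tⱼ = k! ∫ 1`, while the simplex has volume `1 / k!`. -/
lemma integral_elementary_self {n k : ℕ} {i : Fin (k + 1) → Fin (n + 1)}
    (hi : Function.Injective i) : integral K i (elementary K i) = 1 := by
  have h : ∀ j : Fin (k + 1), integral K i ((-1 : K) ^ (j : ℕ) • (coord K (i j) ⊗ₜ[K]
      ExteriorAlgebra.ιMulti K k fun l => covec K (i (j.succAbove l)))) =
      dirichlet K k (coord K j) := by
    intro j
    rw [map_smul, integral_tmul_ιMulti]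
    simp only [pullbackCovec_apply hi, pullbackCoord_apply hi, topCoeff_face, smul_eq_mul]
    rw [mul_left_comm, ← mul_pow, neg_one_mul, neg_neg, one_pow, mul_one]
  rw [elementary_eq, map_smul, map_sum, Finset.sum_congr rfl fun j _ => h j, ← map_sum, sum_coord,
    dirichlet_one, smul_eq_mul, mul_inv_cancel₀ (Nat.cast_ne_zero.2 (Nat.factorial_ne_zero _))]

/-- Some vertex of `i` is missing from `j`. Every summand of the elementary form contains the
coordinate of that vertex or its differential, and both restrict to zero on the face `j`. -/
lemma integral_elementary_of_ne {n k : ℕ} {i j : Fin (k + 1) → Fin (n + 1)} (hi : StrictMono i)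
    (hj : StrictMono j) (h : i ≠ j) : integral K j (elementary K i) = 0 := by
  obtain ⟨a, ha⟩ : ∃ a, ∀ b, j b ≠ i a := by
    by_contra! hc
    exact h (strictMono_eq_of_range hi hj hc)
  rw [elementary_eq, map_smul, map_sum, Finset.sum_eq_zero, smul_zero]
  intro c _
  rw [map_smul, integral_tmul_ιMulti]
  by_cases hc : c = a
  · rw [hc, pullbackCoord_eq_zero K ha, map_zero, zero_mul, smul_zero]
  · obtain ⟨l, hl⟩ := Fin.exists_succAbove_eq (Ne.symm hc)
    rw [(ExteriorAlgebra.ιMulti K k).map_coord_zero l, map_zero, mul_zero, smul_zero]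
    rw [hl, pullbackCovec_eq_zero K ha]

lemma integral_elementary_of_length_ne {n k l : ℕ} (i : Fin (k + 1) → Fin (n + 1))
    (j : Fin (l + 1) → Fin (n + 1)) (h : k ≠ l) : integral K j (elementary K i) = 0 :=
  integral_eq_zero_of_mem K j h (elementary_mem_degreePart K i)

/-- Stokes' theorem for elementary forms. -/
lemma integral_d_elementary {n k l : ℕ} {i : Fin (k + 1) → Fin (n + 1)} (hi : StrictMono i)
    {j : Fin (l + 2) → Fin (n + 1)} (hj : StrictMono j) :
    integral K j (d K n (elementary K i)) =
      ∑ a : Fin (l + 2), (-1 : K) ^ (a : ℕ) * integral K (j ∘ a.succAbove) (elementary K i) := by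
  by_cases hkl : k = l
  · subst hkl
    have hja : ∀ a : Fin (k + 2), StrictMono (j ∘ a.succAbove) := fun a =>
      hj.comp (Fin.strictMono_succAbove a)
    rw [d_elementary, map_smul, integral_tmul_ιMulti]
    by_cases h : ∃ a : Fin (k + 2), i = j ∘ a.succAbove
    · obtain ⟨a, rfl⟩ := h
      simp only [Function.comp_apply, pullbackCovec_apply hj.injective, topCoeff_face]
      rw [map_one, dirichlet_one, smul_eq_mul,
        mul_inv_cancel_left₀ (Nat.cast_ne_zero.2 (Nat.factorial_ne_zero _)),
        Finset.sum_eq_single a, integral_elementary_self K (hja a).injective, mul_one]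
      · intro b _ hb
        rw [integral_elementary_of_ne K (hja a) (hja b), mul_zero]
        intro hc
        refine hb (Fin.succAbove_left_injective ?_)
        exact (hj.injective.comp_left hc).symm
      · simp
    · rw [Finset.sum_eq_zero fun a _ => by
        rw [integral_elementary_of_ne K hi (hja a) fun hc => h ⟨a, hc⟩, mul_zero]]
      -- If all vertices of `i` were among those of `j`, then `i` would be `j` composed with an
      -- increasing map that misses exactly one index, that is, a codimension-one face of `j`, which
      -- is excluded here.
      obtain ⟨a, ha⟩ : ∃ a, ∀ b, j b ≠ i a := by
        by_contra! hc
        choose c hc using hc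
        have hcm : StrictMono c := fun x y hxy =>
          hj.lt_iff_lt.1 (by rw [hc, hc]; exact hi hxy)
        obtain ⟨a, ha⟩ : ∃ a, ∀ x, c x ≠ a := by
          by_contra! hs
          simpa using Fintype.card_le_of_surjective c hs
        refine h ⟨a, ?_⟩
        rw [← strictMono_eq_of_range hcm (Fin.strictMono_succAbove a)
          fun x => Fin.exists_succAbove_eq (ha x)]
        exact funext fun x => (hc x).symm
      rw [(ExteriorAlgebra.ιMulti K (k + 1)).map_coord_zero a, map_zero, mul_zero, smul_zero]
      exact pullbackCovec_eq_zero K ha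
  · rw [integral_eq_zero_of_mem K j (p := k + 1) (by omega)
      (d_mem_degreePart K (elementary_mem_degreePart K i)), Finset.sum_eq_zero]
    intro a _
    rw [integral_elementary_of_length_ne K i _ hkl, mul_zero]

lemma integral_d_vertex {n : ℕ} (j : Fin 1 → Fin (n + 1)) (x : Forms K n) :
    integral K j (d K n x) = 0 := by
  refine forms_induction K (p := fun x => integral K j (d K n x) = 0) ?_ ?_ ?_ x
  · simp only [map_zero]
  · intro x y hx hy
    rw [map_add, map_add, hx, hy, add_zero]
  · intro r k v
    exact integral_eq_zero_of_mem K j (Nat.succ_ne_zero k)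
      (d_mem_degreePart K (tmul_ιMulti_mem_degreePart K r v))

lemma integral_pullback {m n k : ℕ} (f : Fin (m + 1) → Fin (n + 1)) (i : Fin (k + 1) → Fin (m + 1))
    (x : Forms K n) : integral K i (pullback K f x) = integral K (f ∘ i) x := by
  rw [integral, integral, LinearMap.comp_apply, LinearMap.comp_apply, pullback_comp]
  rfl

/-! ### Whitney's projection and gauges -/

open Classical in
lemma whitney_apply {n : ℕ} (x : Forms K n) :
    whitney K n x = ∑ k ∈ Finset.range (n + 1), ∑ i : Fin (k + 1) → Fin (n + 1) with StrictMono i,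
      integral K i x • elementary K i := by
  simp only [whitney, LinearMap.sum_apply, LinearMap.smulRight_apply]

namespace Gauge

variable {K} (s : Gauge K)

/-- Only the degree `k` part of `s x` can contribute; it comes from forms of degree `k + 1` on a
`k`-simplex, and these are zero. -/
lemma integralTop_s {k : ℕ} (x : Forms K k) : integralTop K k (s.s k x) = 0 := by
  have hid : integralTop K k = integral K (id : Fin (k + 1) → Fin (k + 1)) := by
    rw [integral, pullback_id]
    rfl
  rw [hid]
  refine forms_induction K (p := fun x => integral K id (s.s k x) = 0) ?_ ?_ ?_ x
  · simp only [map_zero]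
  · intro x y hx hy
    rw [map_add, map_add, hx, hy, add_zero]
  · intro r p v
    have hm := tmul_ιMulti_mem_degreePart K r v
    match p, v, hm with
    | 0, v, hm => rw [s.degree_zero k _ hm, map_zero]
    | p + 1, v, hm =>
      by_cases hp : p = k
      · subst hp
        rw [ιMulti_eq_zero K (Nat.lt_succ_self p), TensorProduct.tmul_zero, map_zero, map_zero]
      · exact integral_eq_zero_of_mem K id hp (s.degree_succ k p _ hm)

/-- Simpliciality moves `s` past the restriction to the face, which reduces this to the
top-dimensional case. -/
lemma integral_s {n k : ℕ} {i : Fin (k + 1) → Fin (n + 1)} (hi : Monotone i) (x : Forms K n) :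
    integral K i (s.s n x) = 0 := by
  rw [integral, LinearMap.comp_apply, AlgHom.toLinearMap_apply, s.simplicial i hi, integralTop_s]

lemma whitney_s {n : ℕ} (x : Forms K n) : whitney K n (s.s n x) = 0 := by
  rw [whitney_apply]
  refine Finset.sum_eq_zero fun k _ => Finset.sum_eq_zero fun i hi => ?_
  rw [s.integral_s (Finset.mem_filter.1 hi).2.monotone, zero_smul]

/-- Applying `s` to the homotopy formula for `x` gives `sx - sPx = sdsx`; the formula for `sx`,
together with `Ps = 0`, gives `sx = sdsx`. -/
lemma s_whitney {n : ℕ} (x : Forms K n) : s.s n (whitney K n x) = 0 := by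
  have h1 := congrArg (s.s n) (s.contraction n x)
  have h2 := s.contraction n (s.s n x)
  rw [map_sub, map_add, s.square_zero, add_zero] at h1
  rw [s.whitney_s, s.square_zero, map_zero, zero_add, sub_zero] at h2
  rw [← h2, sub_eq_self] at h1
  exact h1

end Gauge

/-- Both `dx - dPx` and `dx - Pdx` equal `dsdx` by the homotopy formula. Having a gauge thus
replaces Stokes' theorem for arbitrary forms. -/
lemma Gauge.whitney_d {K : Type u} [Field K] [CharZero K] (s : Gauge K) {n : ℕ}
    (x : Forms K n) : whitney K n (d K n x) = d K n (whitney K n x) := by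
  have h1 := congrArg (d K n) (s.contraction n x)
  have h2 := s.contraction n (d K n x)
  rw [map_sub, map_add, d_d, zero_add] at h1
  rw [d_d, map_zero, add_zero, ← h1] at h2
  exact sub_right_injective h2

lemma whitney_elementary {n k : ℕ} {i : Fin (k + 1) → Fin (n + 1)} (hi : StrictMono i) :
    whitney K n (elementary K i) = elementary K i := by
  rw [whitney_apply, Finset.sum_eq_single k, Finset.sum_eq_single i,
    integral_elementary_self K hi.injective, one_smul]
  · intro j hj hne
    rw [integral_elementary_of_ne K hi (Finset.mem_filter.1 hj).2 hne.symm, zero_smul]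
  · exact fun h => absurd (Finset.mem_filter.2 ⟨Finset.mem_univ _, hi⟩) h
  · intro l _ hl
    refine Finset.sum_eq_zero fun j _ => ?_
    rw [integral_elementary_of_length_ne K i j hl.symm, zero_smul]
  · exact fun h => absurd (Finset.mem_range.2 (strictMono_lt hi)) h

end CharZero

end PolyForm

namespace LInfinityAlgebra

open PolyForm

variable {K : Type u} [Field K] (g : LInfinityAlgebra K) {n : ℕ}

/-! ### Integration of forms with values in an `L∞`-algebra -/

/-- The map `x ⊗ a ↦ l a • x`. -/
def contract (l : Forms K n →ₗ[K] K) : g.carrier ⊗[K] Forms K n →ₗ[K] g.carrier :=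
  (TensorProduct.rid K g.carrier).toLinearMap ∘ₗ TensorProduct.map LinearMap.id l

@[simp]
lemma contract_tmul (l : Forms K n →ₗ[K] K) (x : g.carrier) (a : Forms K n) :
    g.contract l (x ⊗ₜ a) = l a • x := rfl

lemma contract_map_id (l : Forms K n →ₗ[K] K) (f : Forms K n →ₗ[K] Forms K n)
    (α : g.carrier ⊗[K] Forms K n) :
    g.contract l (TensorProduct.map LinearMap.id f α) = g.contract (l ∘ₗ f) α := by
  induction α using TensorProduct.induction_on with
  | zero => simp only [map_zero]
  | add x y hx hy => simp only [map_add, hx, hy]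
  | tmul x a => rfl

lemma contract_sum_smul {ι : Type*} (s : Finset ι) (c : ι → K) (l : ι → Forms K n →ₗ[K] K)
    (α : g.carrier ⊗[K] Forms K n) :
    g.contract (∑ i ∈ s, c i • l i) α = ∑ i ∈ s, c i • g.contract (l i) α := by
  induction α using TensorProduct.induction_on with
  | zero => simp only [map_zero, smul_zero, Finset.sum_const_zero]
  | add x y hx hy => simp only [map_add, hx, hy, smul_add, Finset.sum_add_distrib]
  | tmul x a =>
    simp only [contract_tmul, LinearMap.sum_apply, LinearMap.smul_apply, Finset.sum_smul,
      smul_assoc]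

lemma contract_map_delta (l : Forms K n →ₗ[K] K) (α : g.carrier ⊗[K] Forms K n) :
    g.contract l (TensorProduct.map g.delta LinearMap.id α) = g.delta (g.contract l α) := by
  induction α using TensorProduct.induction_on with
  | zero => simp only [map_zero]
  | add x y hx hy => simp only [map_add, hx, hy]
  | tmul x a => simp only [TensorProduct.map_tmul, contract_tmul, map_smul, LinearMap.id_apply]

lemma totalDegree_induction {i : ℤ} {p : g.carrier ⊗[K] Forms K n → Prop} (h0 : p 0)
    (hadd : ∀ x y, p x → p y → p (x + y))
    (h : ∀ (q : ℕ) (x : g.carrier) (a : Forms K n), x ∈ g.gr (i - q) → a ∈ degreePart K n q →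
      p (x ⊗ₜ a)) {α : g.carrier ⊗[K] Forms K n} (hα : α ∈ g.totalDegree n i) : p α := by
  refine Submodule.iSup_induction _ (motive := p) hα ?_ h0 hadd
  rintro q _ ⟨z, rfl⟩
  induction z using TensorProduct.induction_on with
  | zero => rwa [map_zero]
  | add x y hx hy =>
    rw [map_add]
    exact hadd _ _ hx hy
  | tmul x a => exact h q x a x.2 a.2

lemma tmul_mem_totalDegree {i : ℤ} {q : ℕ} {x : g.carrier} {a : Forms K n}
    (hx : x ∈ g.gr (i - q)) (ha : a ∈ degreePart K n q) : x ⊗ₜ a ∈ g.totalDegree n i :=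
  Submodule.mem_iSup_of_mem q ⟨⟨x, hx⟩ ⊗ₜ ⟨a, ha⟩, rfl⟩

lemma parity_parity (x : g.carrier) : g.parity (g.parity x) = x := by
  refine g.induction_homogeneous (p := fun x => g.parity (g.parity x) = x) ?_ ?_ ?_ x
  · simp only [map_zero]
  · intro x y hx hy
    simp only [map_add, hx, hy]
  · intro i x hx
    rw [g.parity_of_mem hx, map_smul, g.parity_of_mem hx, smul_smul, ← Int.cast_mul,
      ← Units.val_mul, Int.units_mul_self, Units.val_one, Int.cast_one, one_smul]

lemma parity_delta (x : g.carrier) : g.parity (g.delta x) = -g.delta (g.parity x) := by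
  refine g.induction_homogeneous (p := fun x => g.parity (g.delta x) = -g.delta (g.parity x))
    ?_ ?_ ?_ x
  · simp only [map_zero, neg_zero]
  · intro x y hx hy
    simp only [map_add, hx, hy, neg_add]
  · intro i x hx
    rw [g.parity_of_mem hx, map_smul, g.parity_of_mem (g.delta_mem hx), Int.negOnePow_succ,
      Units.val_neg, Int.cast_neg, neg_smul]

lemma curvature_of_isAbelian {g : LInfinityAlgebra K} (hg : g.IsAbelian)
    (α : g.carrier ⊗[K] Forms K n) : g.curvature n α = g.totalDiff n α := by
  have h : ∀ l : ℕ, g.bracketForms n (l + 2) = 0 := by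
    intro l
    have hz : ∀ p : Fin (l + 2) → Fin 2,
        (g.bracket (l + 2)).compLinearMap (fun j => parityProj g.parity (p j)) = 0 := by
      intro p
      rw [hg (l + 2) (by omega)]
      rfl
    rw [bracketForms]
    simp only [hz, map_zero, LinearMap.zero_apply, smul_zero, Finset.sum_const_zero]
  rw [curvature]
  simp only [h, zero_apply, smul_zero, finsum_zero, add_zero]

/-! ### Elementary forms with coefficients in the algebra -/

open Classical in
/-- The sum of the `a_{i₀ ⋯ iₖ} ⊗ ω_{i₀ ⋯ iₖ}`. -/
def elementarySum (a : ∀ k : ℕ, (Fin (k + 1) → Fin (n + 1)) → g.carrier) :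
    g.carrier ⊗[K] Forms K n :=
  ∑ k ∈ Finset.range (n + 1), ∑ i : Fin (k + 1) → Fin (n + 1) with StrictMono i,
    a k i ⊗ₜ elementary K i

variable {a : ∀ k : ℕ, (Fin (k + 1) → Fin (n + 1)) → g.carrier}

lemma elementarySum_congr {b : ∀ k : ℕ, (Fin (k + 1) → Fin (n + 1)) → g.carrier}
    (h : ∀ k i, StrictMono i → a k i = b k i) : g.elementarySum a = g.elementarySum b :=
  Finset.sum_congr rfl fun k _ => Finset.sum_congr rfl fun i hi => by
    rw [h k i (Finset.mem_filter.1 hi).2]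

lemma elementarySum_mem
    (h : ∀ (k : ℕ) (i : Fin (k + 1) → Fin (n + 1)), StrictMono i → a k i ∈ g.gr (1 - k)) :
    g.elementarySum a ∈ g.totalDegree n 1 :=
  Submodule.sum_mem _ fun k _ => Submodule.sum_mem _ fun i hi =>
    g.tmul_mem_totalDegree (h k i (Finset.mem_filter.1 hi).2) (elementary_mem_degreePart K i)

section CharZero

variable [CharZero K]

lemma contract_mem {k : ℕ} (i : Fin (k + 1) → Fin (n + 1)) {α : g.carrier ⊗[K] Forms K n}
    (hα : α ∈ g.totalDegree n 1) : g.contract (integral K i) α ∈ g.gr (1 - k) := by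
  refine g.totalDegree_induction (p := fun α => g.contract (integral K i) α ∈ g.gr (1 - k))
    ?_ ?_ ?_ hα
  · rw [map_zero]
    exact zero_mem _
  · intro x y hx hy
    rw [map_add]
    exact add_mem hx hy
  · intro q x a hx ha
    rw [contract_tmul]
    by_cases hq : q = k
    · subst hq
      exact Submodule.smul_mem _ _ hx
    · rw [integral_eq_zero_of_mem K i hq ha, zero_smul]
      exact zero_mem _

lemma contract_of_not_injective {k : ℕ} (i : Fin (k + 1) → Fin (n + 1))
    (hi : ¬ Function.Injective i) (α : g.carrier ⊗[K] Forms K n) :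
    g.contract (integral K i) α = 0 := by
  have : integral K i = 0 := LinearMap.ext fun x => integral_of_not_injective K i hi x
  rw [this, contract, TensorProduct.map_zero_right, LinearMap.comp_zero, LinearMap.zero_apply]

lemma contract_formsMap {g h : LInfinityAlgebra K} (φ : g ⟶ h) {m k : ℕ}
    (f : Fin (m + 1) → Fin (n + 1)) (i : Fin (k + 1) → Fin (m + 1))
    (α : g.carrier ⊗[K] Forms K n) :
    h.contract (integral K i) (formsMap φ f α) =
      Hom.toLin φ (g.contract (integral K (f ∘ i)) α) := by
  induction α using TensorProduct.induction_on with
  | zero => simp only [map_zero]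
  | add x y hx hy => simp only [map_add, hx, hy]
  | tmul x a =>
    simp only [formsMap, TensorProduct.map_tmul, contract_tmul, AlgHom.toLinearMap_apply,
      integral_pullback, map_smul]

lemma contract_map_parity_d_vertex (i : Fin 1 → Fin (n + 1)) (α : g.carrier ⊗[K] Forms K n) :
    g.contract (integral K i) (TensorProduct.map g.parity (d K n) α) = 0 := by
  induction α using TensorProduct.induction_on with
  | zero => simp only [map_zero]
  | add x y hx hy => simp only [map_add, hx, hy, add_zero]
  | tmul x a => rw [TensorProduct.map_tmul, contract_tmul, integral_d_vertex, zero_smul]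

/-- Only the component with form degree `k` survives the integration. In total degree 1 its
coefficients lie in `g^{1-k}`, which accounts for the sign. -/
lemma contract_map_parity_d {k : ℕ} (i : Fin (k + 2) → Fin (n + 1))
    {α : g.carrier ⊗[K] Forms K n} (hα : α ∈ g.totalDegree n 1) :
    g.contract (integral K i) (TensorProduct.map g.parity (d K n) α) =
      (-1 : K) ^ (k + 1) • g.contract (integral K i ∘ₗ d K n) α := by
  refine g.totalDegree_induction (p := fun α => g.contract (integral K i)
    (TensorProduct.map g.parity (d K n) α) =
      (-1 : K) ^ (k + 1) • g.contract (integral K i ∘ₗ d K n) α) ?_ ?_ ?_ hα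
  · simp only [map_zero, smul_zero]
  · intro x y hx hy
    simp only [map_add, hx, hy, smul_add]
  · intro q x a hx ha
    rw [TensorProduct.map_tmul, contract_tmul, contract_tmul, LinearMap.comp_apply]
    by_cases hq : q = k
    · subst hq
      have hs : (((1 - q : ℤ).negOnePow : ℤ) : K) = (-1 : K) ^ (q + 1) := by
        rw [Int.negOnePow_sub, mul_comm, ← Int.negOnePow_add, ← Nat.cast_succ, Int.negOnePow_def,
          zpow_natCast]
        simp
      rw [g.parity_of_mem hx, hs, smul_comm]
    · rw [integral_eq_zero_of_mem K i (by omega) (d_mem_degreePart K ha), zero_smul, zero_smul,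
        smul_zero]

lemma map_whitney (α : g.carrier ⊗[K] Forms K n) :
    TensorProduct.map LinearMap.id (whitney K n) α =
      g.elementarySum fun _ i => g.contract (integral K i) α := by
  rw [elementarySum]
  induction α using TensorProduct.induction_on with
  | zero => simp only [map_zero, TensorProduct.zero_tmul, Finset.sum_const_zero]
  | add x y hx hy => simp only [map_add, hx, hy, TensorProduct.add_tmul, Finset.sum_add_distrib]
  | tmul x a =>
    simp only [TensorProduct.map_tmul, LinearMap.id_apply, whitney_apply, TensorProduct.tmul_sum,
      contract_tmul, TensorProduct.smul_tmul]

lemma contract_elementarySum {k : ℕ} {i : Fin (k + 1) → Fin (n + 1)} (hi : StrictMono i) :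
    g.contract (integral K i) (g.elementarySum a) = a k i := by
  simp only [elementarySum, map_sum, contract_tmul]
  rw [Finset.sum_eq_single k, Finset.sum_eq_single i,
    integral_elementary_self K hi.injective, one_smul]
  · intro j hj hne
    rw [integral_elementary_of_ne K (Finset.mem_filter.1 hj).2 hi hne, zero_smul]
  · exact fun h => absurd (Finset.mem_filter.2 ⟨Finset.mem_univ _, hi⟩) h
  · intro l _ hl
    refine Finset.sum_eq_zero fun j _ => ?_
    rw [integral_elementary_of_length_ne K j i hl, zero_smul]
  · exact fun h => absurd (Finset.mem_range.2 (strictMono_lt hi)) h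

lemma map_whitney_elementarySum :
    TensorProduct.map LinearMap.id (whitney K n) (g.elementarySum a) = g.elementarySum a := by
  rw [map_whitney]
  exact g.elementarySum_congr fun k i hi => g.contract_elementarySum hi

/-! ### Maurer-Cartan elements in the gauge -/

lemma gaugeAction_elementarySum (s : Gauge K) : gaugeAction s g n (g.elementarySum a) = 0 := by
  rw [elementarySum, map_sum]
  refine Finset.sum_eq_zero fun k _ => ?_
  rw [map_sum]
  refine Finset.sum_eq_zero fun i hi => ?_
  rw [gaugeAction, TensorProduct.map_tmul, ← whitney_elementary K (Finset.mem_filter.1 hi).2,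
    s.s_whitney, TensorProduct.tmul_zero]

variable {g}

/-- The formula `α - Pα = DSα + SDα` for `D = d + δ` and the gauge action `S`, whose right side
vanishes here. -/
lemma map_whitney_of_gaugeAction_eq_zero (s : Gauge K) {α : g.carrier ⊗[K] Forms K n}
    (hd : g.totalDiff n α = 0) (hs : gaugeAction s g n α = 0) :
    TensorProduct.map LinearMap.id (whitney K n) α = α := by
  -- The signs of the two operators cancel, since the parity involution squares to the identity.
  have h1 : ∀ β : g.carrier ⊗[K] Forms K n,
      β - TensorProduct.map LinearMap.id (whitney K n) β =
        TensorProduct.map g.parity (d K n) (gaugeAction s g n β) +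
          gaugeAction s g n (TensorProduct.map g.parity (d K n) β) := by
    intro β
    induction β using TensorProduct.induction_on with
    | zero => simp only [map_zero, sub_zero, add_zero]
    | add x y hx hy =>
      rw [map_add, add_sub_add_comm, hx, hy]
      simp only [map_add]
      abel
    | tmul x b =>
      simp only [gaugeAction, TensorProduct.map_tmul, parity_parity, LinearMap.id_apply,
        ← TensorProduct.tmul_add, ← TensorProduct.tmul_sub, s.contraction]
  -- As `δ` is odd, it anticommutes with the gauge action, so it contributes nothing to the
  -- commutator `DS + SD`.
  have h2 : ∀ β : g.carrier ⊗[K] Forms K n,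
      gaugeAction s g n (TensorProduct.map g.delta LinearMap.id β) =
        -TensorProduct.map g.delta LinearMap.id (gaugeAction s g n β) := by
    intro β
    induction β using TensorProduct.induction_on with
    | zero => simp only [map_zero, neg_zero]
    | add x y hx hy => simp only [map_add, hx, hy, neg_add]
    | tmul x b =>
      simp only [gaugeAction, TensorProduct.map_tmul, LinearMap.id_apply, parity_delta,
        TensorProduct.neg_tmul]
  have h3 : TensorProduct.map g.parity (d K n) α = -TensorProduct.map g.delta LinearMap.id α :=
    eq_neg_of_add_eq_zero_right hd
  have h4 := h1 α
  rw [hs, map_zero, zero_add, h3, map_neg, h2, hs, map_zero, neg_zero, neg_zero, sub_eq_zero] at h4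
  exact h4.symm

lemma totalDiff_map_whitney (s : Gauge K) (α : g.carrier ⊗[K] Forms K n) :
    TensorProduct.map LinearMap.id (whitney K n) (g.totalDiff n α) =
      g.totalDiff n (TensorProduct.map LinearMap.id (whitney K n) α) := by
  induction α using TensorProduct.induction_on with
  | zero => simp only [map_zero]
  | add x y hx hy => simp only [map_add, hx, hy]
  | tmul x b =>
    simp only [totalDiff, LinearMap.add_apply, TensorProduct.map_tmul, map_add, LinearMap.id_apply,
      s.whitney_d]

lemma contract_totalDiff_vertex (i : Fin 1 → Fin (n + 1)) (α : g.carrier ⊗[K] Forms K n) :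
    g.contract (integral K i) (g.totalDiff n α) = g.delta (g.contract (integral K i) α) := by
  rw [totalDiff, LinearMap.add_apply, map_add, contract_map_delta, contract_map_parity_d_vertex,
    add_zero]

/-- Stokes' formula has been shown on elementary forms only. The hypothesis `hP` suffices, because
two functionals that agree on elementary forms agree after composition with Whitney's projection. -/
lemma contract_totalDiff {k : ℕ} {i : Fin (k + 2) → Fin (n + 1)} (hi : StrictMono i)
    {α : g.carrier ⊗[K] Forms K n} (hα : α ∈ g.totalDegree n 1)
    (hP : TensorProduct.map LinearMap.id (whitney K n) α = α) :
    g.contract (integral K i) (g.totalDiff n α) = g.delta (g.contract (integral K i) α) +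
      (-1 : K) ^ (k + 1) • ∑ b : Fin (k + 2), (-1 : K) ^ (b : ℕ) •
        g.contract (integral K (i ∘ b.succAbove)) α := by
  have h : (integral K i ∘ₗ d K n) ∘ₗ whitney K n =
      (∑ b : Fin (k + 2), (-1 : K) ^ (b : ℕ) • integral K (i ∘ b.succAbove)) ∘ₗ whitney K n := by
    refine LinearMap.ext fun x => ?_
    simp only [LinearMap.comp_apply, whitney_apply, map_sum, map_smul]
    refine Finset.sum_congr rfl fun l _ => Finset.sum_congr rfl fun j hj => ?_
    rw [integral_d_elementary K (Finset.mem_filter.1 hj).2 hi]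
    simp only [LinearMap.sum_apply, LinearMap.smul_apply, smul_eq_mul]
  rw [totalDiff, LinearMap.add_apply, map_add, contract_map_delta, g.contract_map_parity_d i hα,
    ← contract_sum_smul]
  congr 2
  rw [← hP, contract_map_id, contract_map_id, h]

-- The total differential commutes with Whitney's projection, so that of an elementary sum is again
-- an elementary sum, with its integrals as coefficients; the hypotheses say that these integrals
-- vanish.
variable (g) in
lemma totalDiff_elementarySum (s : Gauge K)
    (hmem : ∀ (k : ℕ) (i : Fin (k + 1) → Fin (n + 1)), StrictMono i → a k i ∈ g.gr (1 - k))
    (h0 : ∀ i, StrictMono i → g.delta (a 0 i) = 0)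
    (h : ∀ (k : ℕ) (i : Fin (k + 2) → Fin (n + 1)), StrictMono i → g.delta (a (k + 1) i) +
      (-1 : K) ^ (k + 1) • ∑ b : Fin (k + 2), (-1 : K) ^ (b : ℕ) • a k (i ∘ b.succAbove) = 0) :
    g.totalDiff n (g.elementarySum a) = 0 := by
  rw [← map_whitney_elementarySum, ← totalDiff_map_whitney s, map_whitney]
  refine (g.elementarySum_congr (b := fun _ _ => 0) ?_).trans ?_
  · intro k i hi
    cases k with
    | zero => rw [contract_totalDiff_vertex, contract_elementarySum g hi, h0 i hi]
    | succ k =>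
      rw [contract_totalDiff hi (g.elementarySum_mem hmem) g.map_whitney_elementarySum,
        contract_elementarySum g hi, ← h k i hi]
      congr 2
      refine Finset.sum_congr rfl fun b _ => ?_
      rw [contract_elementarySum g (hi.comp (Fin.strictMono_succAbove b))]
  · simp only [elementarySum, TensorProduct.zero_tmul, Finset.sum_const_zero]

end CharZero

end LInfinityAlgebra

/-! ### Morphisms out of the extension of a complex -/

namespace ComplexShape.Embedding

open HomologicalComplex Limits

variable {ι ι' : Type*} {c : ComplexShape ι} {c' : ComplexShape ι'} (e : Embedding c c')
  {C : Type*} [Category* C] [HasZeroMorphisms C] [HasZeroObject C]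
  {A : HomologicalComplex C c} {B : HomologicalComplex C c'}

open scoped Classical in
/-- The components of `descExtend`. -/
def descExtendF (φ : ∀ i, A.X i ⟶ B.X (e.f i)) (i' : ι') : (A.extend e).X i' ⟶ B.X i' :=
  if hi' : ∃ i, e.f i = i' then
    (A.extendXIso e hi'.choose_spec).hom ≫ φ hi'.choose ≫ eqToHom (congrArg B.X hi'.choose_spec)
  else 0

lemma descExtendF_eq (φ : ∀ i, A.X i ⟶ B.X (e.f i)) (i : ι) :
    e.descExtendF φ (e.f i) = (A.extendXIso e rfl).hom ≫ φ i := by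
  have hi' : ∃ k, e.f k = e.f i := ⟨i, rfl⟩
  have h : ∀ (k : ι) (hk : e.f k = e.f i), (A.extendXIso e hk).hom ≫ φ k ≫
      eqToHom (congrArg B.X hk) = (A.extendXIso e rfl).hom ≫ φ i := by
    intro k hk
    obtain rfl := e.injective_f hk
    rw [eqToHom_refl, Category.comp_id]
  rw [descExtendF, dif_pos hi']
  exact h _ _

/-- The morphism `A.extend e ⟶ B` with given components `A.X i ⟶ B.X (e.f i)`. -/
def descExtend (φ : ∀ i, A.X i ⟶ B.X (e.f i))
    (hφ : ∀ i j, c.Rel i j → φ i ≫ B.d (e.f i) (e.f j) = A.d i j ≫ φ j)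
    (hφ' : ∀ i j', c'.Rel (e.f i) j' → (∀ j, e.f j ≠ j') → φ i ≫ B.d (e.f i) j' = 0)
    [e.IsRelIff] : A.extend e ⟶ B where
  f i' := e.descExtendF φ i'
  comm' i' j' hij' := by
    by_cases hi' : ∃ i, e.f i = i'
    · obtain ⟨i, rfl⟩ := hi'
      rw [descExtendF_eq]
      by_cases hj' : ∃ j, e.f j = j'
      · obtain ⟨j, rfl⟩ := hj'
        rw [descExtendF_eq, A.extend_d_eq e rfl rfl]
        simp only [Category.assoc, Iso.inv_hom_id_assoc, hφ i j (e.rel_iff i j |>.1 hij')]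
      · rw [not_exists] at hj'
        rw [Category.assoc, hφ' i j' hij' hj', comp_zero,
          (A.isZero_extend_X e j' hj').eq_of_src (e.descExtendF φ j') 0, comp_zero]
    · rw [not_exists] at hi'
      exact (A.isZero_extend_X e i' hi').eq_of_src _ _

end ComplexShape.Embedding

/-! ### Normalized chains of a simplicial set, in nonpositive degrees -/

namespace SSet

open Simplicial Limits HomologicalComplex ComplexShape

variable {C : Type*} [Category.{u} C] [Preadditive C] [HasCoproducts.{u} C] [HasZeroObject C]
  {X Y : SSet.{u}} {R : C} {V W : CochainComplex C ℤ}

/-- The value at a simplex of a morphism out of the normalized chains. -/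
def chainEval (f : (X.normalizedChainComplex R).extend embeddingDownNat ⟶ V) {k : ℕ}
    (x : X _⦋k⦌) : R ⟶ V.X (embeddingDownNat.f k) :=
  X.ιNormalizedChainComplex x ≫
    ((X.normalizedChainComplex R).extendXIso embeddingDownNat rfl).inv ≫ f.f _

lemma chainEval_ext {f g : (X.normalizedChainComplex R).extend embeddingDownNat ⟶ V}
    (h : ∀ (k : ℕ) (x : X _⦋k⦌), x ∈ X.nonDegenerate k → chainEval f x = chainEval g x) :
    f = g := by
  ext i'
  by_cases hi' : ∃ k, embeddingDownNat.f k = i'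
  · obtain ⟨k, rfl⟩ := hi'
    rw [← cancel_epi ((X.normalizedChainComplex R).extendXIso embeddingDownNat rfl).inv]
    exact normalizedChainComplex_hom_ext X fun x hx => h k x hx
  · rw [not_exists] at hi'
    exact ((X.normalizedChainComplex R).isZero_extend_X _ i' hi').eq_of_src _ _

lemma chainEval_d (f : (X.normalizedChainComplex R).extend embeddingDownNat ⟶ V) {k : ℕ}
    (x : X _⦋k + 1⦌) :
    chainEval f x ≫ V.d _ (embeddingDownNat.f k) =
      ∑ i : Fin (k + 2), (-1) ^ (i : ℕ) • chainEval f (X.δ i x) := by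
  rw [chainEval, Category.assoc, Category.assoc, f.comm,
    (X.normalizedChainComplex R).extend_d_eq embeddingDownNat rfl rfl]
  simp only [Category.assoc, Iso.inv_hom_id_assoc]
  rw [← Category.assoc, ιNormalizedChainComplex_d, Preadditive.sum_comp]
  refine Finset.sum_congr rfl fun i _ => ?_
  rw [Preadditive.zsmul_comp]
  rfl

/-- The extended chain complex is zero in positive degrees, so vertices are sent to cocycles. -/
lemma chainEval_d_vertex (f : (X.normalizedChainComplex R).extend embeddingDownNat ⟶ V)
    (x : X _⦋0⦌) (j : ℤ) (hj : 0 < j) : chainEval f x ≫ V.d _ j = 0 := by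
  rw [chainEval, Category.assoc, Category.assoc, f.comm,
    ((X.normalizedChainComplex R).isZero_extend_X embeddingDownNat j ?_).eq_of_tgt
      (((X.normalizedChainComplex R).extend embeddingDownNat).d _ j) 0]
  · simp
  · intro k hk
    have : -(k : ℤ) = j := hk
    omega

lemma chainEval_comp (f : (X.normalizedChainComplex R).extend embeddingDownNat ⟶ V) (φ : V ⟶ W)
    {k : ℕ} (x : X _⦋k⦌) : chainEval (f ≫ φ) x = chainEval f x ≫ φ.f _ := by
  simp only [chainEval, comp_f, Category.assoc]

lemma chainEval_extendMap (h : X ⟶ Y)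
    (f : (Y.normalizedChainComplex R).extend embeddingDownNat ⟶ V) {k : ℕ} (x : X _⦋k⦌) :
    chainEval (extendMap (normalizedChainComplexMap h R) embeddingDownNat ≫ f) x =
      chainEval f (h.app _ x) := by
  rw [chainEval, comp_f, extendMap_f _ embeddingDownNat rfl]
  simp only [Category.assoc, Iso.inv_hom_id_assoc]
  rw [ι_normalizedChainComplexMap_f_assoc]
  rfl

/-- The normalized `k`-chains are the coproduct of copies of `R` over the nondegenerate
`k`-simplices, so the boundary condition need only be checked on those. -/
lemma exists_chainEval_eq (c : ∀ k : ℕ, X _⦋k⦌ → (R ⟶ V.X (embeddingDownNat.f k)))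
    (hc : ∀ k, ∀ x ∈ X.degenerate k, c k x = 0)
    (hd : ∀ (k : ℕ) (x : X _⦋k + 1⦌), x ∈ X.nonDegenerate (k + 1) →
      c (k + 1) x ≫ V.d _ (embeddingDownNat.f k) =
        ∑ i : Fin (k + 2), (-1) ^ (i : ℕ) • c k (X.δ i x))
    (hd' : ∀ x : X _⦋0⦌, c 0 x ≫ V.d _ 1 = 0) :
    ∃ f : (X.normalizedChainComplex R).extend embeddingDownNat ⟶ V,
      ∀ (k : ℕ) (x : X _⦋k⦌), chainEval f x = c k x := by
  let φ : ∀ k, (X.normalizedChainComplex R).X k ⟶ V.X (embeddingDownNat.f k) := fun k =>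
    Cofan.IsColimit.desc (X.isColimitCofanNormalizedChainComplex R k) fun x => c k x.1
  -- Degenerate simplices are needed too, since a face of a nondegenerate simplex may be degenerate.
  have hφ : ∀ (k : ℕ) (x : X _⦋k⦌), X.ιNormalizedChainComplex x ≫ φ k = c k x := by
    intro k x
    by_cases hx : x ∈ X.degenerate k
    · rw [ιNormalizedChainComplex_eq_zero X x hx, hc k x hx, zero_comp]
    · exact Cofan.IsColimit.fac (X.isColimitCofanNormalizedChainComplex R k) _ ⟨x, hx⟩
  refine ⟨embeddingDownNat.descExtend φ ?_ ?_, ?_⟩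
  · rintro i j hij
    obtain rfl : j + 1 = i := hij
    refine normalizedChainComplex_hom_ext X fun x hx => ?_
    rw [← Category.assoc, hφ, hd j x hx, ← Category.assoc, ιNormalizedChainComplex_d,
      Preadditive.sum_comp]
    refine Finset.sum_congr rfl fun i _ => ?_
    rw [Preadditive.zsmul_comp, hφ]
  · rintro i j' hij hj'
    have h1 : -(i : ℤ) + 1 = j' := hij
    -- A differential leaves the nonpositive degrees only from degree 0 to degree 1.
    cases i with
    | zero =>
      obtain rfl : 1 = j' := by simpa using h1
      refine normalizedChainComplex_hom_ext X fun x hx => ?_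
      rw [← Category.assoc, hφ, hd' x, comp_zero]
    | succ i =>
      refine absurd ?_ (hj' i)
      change -(i : ℤ) = j'
      push_cast at h1
      omega
  · intro k x
    have h := ComplexShape.Embedding.descExtendF_eq embeddingDownNat
      (A := X.normalizedChainComplex R) (B := V) φ k
    change X.ιNormalizedChainComplex x ≫ _ ≫ ComplexShape.Embedding.descExtendF _ φ _ = _
    rw [h, Iso.inv_hom_id_assoc, hφ]

end SSet

namespace LInfinityAlgebra

open PolyForm Simplicial ComplexShape

variable {K : Type u} [Field K]

/-! ### Chains with values in the shifted complex -/

lemma toCochainComplex_d_apply (g : LInfinityAlgebra K) {i j : ℤ} (h : i + 1 = j) (x : g.gr i) :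
    ((((toCochainComplex K).obj g).d i j).hom x : g.gr j).1 = g.delta x.1 := by
  subst h
  have := CochainComplex.of_d (fun i => ModuleCat.of K (g.gr i)) g.deltaHom i
  exact congrArg (fun f : ModuleCat.of K (g.gr i) ⟶ ModuleCat.of K (g.gr (i + 1)) =>
    (f.hom x : g.gr (i + 1)).1) this

/-- The complex `g[1]`. -/
abbrev shiftedComplex (g : LInfinityAlgebra K) : CochainComplex (ModuleCat.{u} K) ℤ :=
  (shiftFunctor (CochainComplex (ModuleCat.{u} K) ℤ) (1 : ℤ)).obj ((toCochainComplex K).obj g)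

/-- Shifting by 1 multiplies the differential by `-1`. -/
lemma shiftedComplex_d_apply (g : LInfinityAlgebra K) {i j : ℤ} (h : i + 1 = j)
    (x : g.gr (i + 1)) :
    (((g.shiftedComplex).d i j).hom x : g.gr (j + 1)).1 = -g.delta x.1 := by
  have h1 : (g.shiftedComplex).d i j = -((toCochainComplex K).obj g).d (i + 1) (j + 1) := by
    rw [CochainComplex.shiftFunctor_obj_d', Int.negOnePow_one, Units.neg_smul, one_smul]
  have h2 := g.toCochainComplex_d_apply (i := i + 1) (j := j + 1) (by omega) x
  rw [← h2]
  exact congrArg (fun f : ModuleCat.of K (g.gr (i + 1)) ⟶ ModuleCat.of K (g.gr (j + 1)) =>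
    (f.hom x : g.gr (j + 1)).1) h1

/-- The complex of normalized chains of a simplicial set, in nonpositive degrees. -/
abbrev normalizedChains (K : Type u) [Field K] (X : SSet.{u}) :
    CochainComplex (ModuleCat.{u} K) ℤ :=
  (X.normalizedChainComplex (ModuleCat.of K K)).extend embeddingDownNat

variable {g : LInfinityAlgebra K} {X Y : SSet.{u}}

/-- The value at a simplex of a morphism from the normalized chains to `g[1]`. -/
def chainValue (f : normalizedChains K X ⟶ g.shiftedComplex) {k : ℕ} (x : X _⦋k⦌) : g.carrier :=
  ((SSet.chainEval f x).hom (1 : K) : g.gr (embeddingDownNat.f k + 1)).1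

lemma degree_eq (k : ℕ) : embeddingDownNat.f k + 1 = 1 - (k : ℤ) := by
  change -(k : ℤ) + 1 = _
  ring

lemma chainValue_mem (f : normalizedChains K X ⟶ g.shiftedComplex) {k : ℕ} (x : X _⦋k⦌) :
    chainValue f x ∈ g.gr (1 - k) := by
  rw [← degree_eq]
  exact ((SSet.chainEval f x).hom (1 : K) : g.gr (embeddingDownNat.f k + 1)).2

lemma chainValue_ext {f f' : normalizedChains K X ⟶ g.shiftedComplex}
    (h : ∀ (k : ℕ) (x : X _⦋k⦌), x ∈ X.nonDegenerate k → chainValue f x = chainValue f' x) :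
    f = f' :=
  SSet.chainEval_ext fun k x hx => ModuleCat.hom_ext (LinearMap.ext_ring (Subtype.ext (h k x hx)))

lemma sum_zsmul_hom_apply {M : Type u} [AddCommGroup M] [Module K M] (p : Submodule K M) {k : ℕ}
    (φ : Fin k → (ModuleCat.of K K ⟶ ModuleCat.of K p)) :
    ((∑ i : Fin k, (-1 : ℤ) ^ (i : ℕ) • φ i).hom (1 : K) : p).1 =
      ∑ i : Fin k, (-1 : K) ^ (i : ℕ) • (((φ i).hom (1 : K) : p) : M) := by
  rw [ModuleCat.hom_sum, LinearMap.sum_apply, AddSubmonoidClass.coe_finsetSum]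
  refine Finset.sum_congr rfl fun i _ => ?_
  rw [ModuleCat.hom_zsmul, LinearMap.smul_apply, ← Int.cast_smul_eq_zsmul K]
  simp

lemma delta_chainValue (f : normalizedChains K X ⟶ g.shiftedComplex) {k : ℕ} (x : X _⦋k + 1⦌) :
    -g.delta (chainValue f x) =
      ∑ i : Fin (k + 2), (-1 : K) ^ (i : ℕ) • chainValue f (X.δ i x) := by
  have h := congrArg (fun φ : ModuleCat.of K K ⟶ ModuleCat.of K (g.gr (embeddingDownNat.f k + 1)) =>
    (φ.hom (1 : K) : g.gr (embeddingDownNat.f k + 1)).1) (SSet.chainEval_d f x)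
  have h1 := g.shiftedComplex_d_apply (i := embeddingDownNat.f (k + 1)) (j := embeddingDownNat.f k)
    (by change -((k + 1 : ℕ) : ℤ) + 1 = -(k : ℤ); push_cast; ring)
    ((SSet.chainEval f x).hom (1 : K))
  exact h1.symm.trans (h.trans (sum_zsmul_hom_apply _ _))

lemma delta_chainValue_vertex (f : normalizedChains K X ⟶ g.shiftedComplex) (x : X _⦋0⦌) :
    g.delta (chainValue f x) = 0 := by
  have h := congrArg (fun φ : ModuleCat.of K K ⟶ ModuleCat.of K (g.gr (1 + 1)) =>
    (φ.hom (1 : K) : g.gr (1 + 1)).1) (SSet.chainEval_d_vertex f x 1 one_pos)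
  have h1 := g.shiftedComplex_d_apply (i := embeddingDownNat.f 0) (j := 1) rfl
    ((SSet.chainEval f x).hom (1 : K))
  exact neg_eq_zero.1 (h1.symm.trans h)

lemma exists_chainValue_eq (c : ∀ k : ℕ, X _⦋k⦌ → g.carrier)
    (hmem : ∀ (k : ℕ) (x : X _⦋k⦌), c k x ∈ g.gr (1 - k))
    (hc : ∀ k, ∀ x ∈ X.degenerate k, c k x = 0)
    (hd : ∀ (k : ℕ) (x : X _⦋k + 1⦌), x ∈ X.nonDegenerate (k + 1) →
      -g.delta (c (k + 1) x) = ∑ i : Fin (k + 2), (-1 : K) ^ (i : ℕ) • c k (X.δ i x))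
    (hd' : ∀ x : X _⦋0⦌, g.delta (c 0 x) = 0) :
    ∃ f : normalizedChains K X ⟶ g.shiftedComplex,
      ∀ (k : ℕ) (x : X _⦋k⦌), chainValue f x = c k x := by
  have hmem' : ∀ (k : ℕ) (x : X _⦋k⦌), c k x ∈ g.gr (embeddingDownNat.f k + 1) := by
    intro k x
    rw [degree_eq]
    exact hmem k x
  let φ : ∀ k : ℕ, X _⦋k⦌ → (ModuleCat.of K K ⟶ (g.shiftedComplex).X (embeddingDownNat.f k)) :=
    fun k x => ModuleCat.ofHom (LinearMap.toSpanSingleton K (g.gr (embeddingDownNat.f k + 1))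
      ⟨c k x, hmem' k x⟩)
  have hφ : ∀ (k : ℕ) (x : X _⦋k⦌),
      ((φ k x).hom (1 : K) : g.gr (embeddingDownNat.f k + 1)).1 = c k x := fun k x => one_smul K _
  refine (SSet.exists_chainEval_eq (V := g.shiftedComplex) φ ?_ ?_ ?_).imp fun f hf k x => ?_
  · intro k x hx
    refine ModuleCat.hom_ext (LinearMap.ext_ring (Subtype.ext ?_))
    exact (hφ k x).trans (hc k x hx)
  · intro k x hx
    refine ModuleCat.hom_ext (LinearMap.ext_ring (Subtype.ext ?_))
    have h1 := g.shiftedComplex_d_apply (i := embeddingDownNat.f (k + 1))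
      (j := embeddingDownNat.f k)
      (by change -((k + 1 : ℕ) : ℤ) + 1 = -(k : ℤ); push_cast; ring) ((φ (k + 1) x).hom (1 : K))
    rw [hφ, hd k x hx] at h1
    exact h1.trans ((sum_zsmul_hom_apply _ fun i => φ k (X.δ i x)).trans
      (Finset.sum_congr rfl fun i _ => congrArg ((-1 : K) ^ (i : ℕ) • ·) (hφ k _))).symm
  · intro x
    refine ModuleCat.hom_ext (LinearMap.ext_ring (Subtype.ext ?_))
    refine (g.shiftedComplex_d_apply (i := embeddingDownNat.f 0) (j := 1) rfl
      ((φ 0 x).hom (1 : K))).trans ?_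
    rw [hφ, hd', neg_zero]
    rfl
  · rw [chainValue, hf]
    exact hφ k x

lemma chainValue_extendMap (h : X ⟶ Y) (f : normalizedChains K Y ⟶ g.shiftedComplex) {k : ℕ}
    (x : X _⦋k⦌) :
    chainValue (HomologicalComplex.extendMap (SSet.normalizedChainComplexMap h (ModuleCat.of K K))
      embeddingDownNat ≫ f) x = chainValue f (h.app _ x) := by
  rw [chainValue, SSet.chainEval_extendMap]
  rfl

lemma chainValue_comp {g' : LInfinityAlgebra K} (f : normalizedChains K X ⟶ g.shiftedComplex)
    (φ : g ⟶ g') {k : ℕ} (x : X _⦋k⦌) :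
    chainValue (f ≫ (shiftFunctor (CochainComplex (ModuleCat.{u} K) ℤ) (1 : ℤ)).map
      ((toCochainComplex K).map φ)) x = Hom.toLin φ (chainValue f x) := by
  rw [chainValue, SSet.chainEval_comp]
  rfl

/-! ### The comparison -/

section Comparison

/-- The sign `(-1)^{k(k+1)/2}`. -/
def chainSign (K : Type u) [Field K] (k : ℕ) : K :=
  ∏ i ∈ Finset.range k, (-1) ^ (i + 1)

/-- With `ε` this sign and `c = ε a`, the recurrence turns `δ a_{k+1} + (-1)^{k+1} ∑ (-1)ᵇ a_k ∂_b =
0` into `-δ c_{k+1} = ∑ (-1)ᵇ c_k ∂_b`, the equation of a chain map to `g[1]`. -/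
lemma chainSign_succ (k : ℕ) : chainSign K (k + 1) = (-1) ^ (k + 1) * chainSign K k := by
  rw [chainSign, Finset.prod_range_succ, mul_comm, chainSign]

lemma chainSign_mul_self (k : ℕ) : chainSign K k * chainSign K k = 1 := by
  induction k with
  | zero => exact one_mul 1
  | succ k ih => rw [chainSign_succ, mul_mul_mul_comm, ih, ← mul_pow, neg_one_mul, neg_neg, one_pow,
      one_mul]

lemma chainSign_smul_smul (k : ℕ) (x : g.carrier) :
    chainSign K k • chainSign K k • x = x := by
  rw [smul_smul, chainSign_mul_self, one_smul]

/-- The vertices of a simplex of `Δⁿ`. -/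
def vertices {n : SimplexCategory} {k : ℕ} (x : (SSet.stdSimplex.{u}.obj n) _⦋k⦌) :
    Fin (k + 1) → Fin (n.len + 1) :=
  (SSet.stdSimplex.objEquiv x).toOrderHom

lemma vertices_δ {n : SimplexCategory} {k : ℕ} (x : (SSet.stdSimplex.{u}.obj n) _⦋k + 1⦌)
    (i : Fin (k + 2)) :
    vertices ((SSet.stdSimplex.{u}.obj n).δ i x) = vertices x ∘ i.succAbove := rfl

lemma vertices_map {m n : SimplexCategory} (f : m ⟶ n) {k : ℕ}
    (x : (SSet.stdSimplex.{u}.obj m) _⦋k⦌) :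
    vertices ((SSet.stdSimplex.{u}.map f).app _ x) = f.toOrderHom ∘ vertices x := rfl

lemma mem_nonDegenerate_iff {n : SimplexCategory} {k : ℕ}
    (x : (SSet.stdSimplex.{u}.obj n) _⦋k⦌) :
    x ∈ (SSet.stdSimplex.{u}.obj n).nonDegenerate k ↔ StrictMono (vertices x) :=
  SSet.stdSimplex.mem_nonDegenerate_iff_strictMono (n := n.len) x

lemma not_injective_of_degenerate {n : SimplexCategory} {k : ℕ}
    {x : (SSet.stdSimplex.{u}.obj n) _⦋k⦌}
    (hx : x ∈ (SSet.stdSimplex.{u}.obj n).degenerate k) : ¬ Function.Injective (vertices x) :=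
  fun h => (mem_nonDegenerate_iff x).2
    ((SSet.stdSimplex.objEquiv x).toOrderHom.monotone.strictMono_of_injective h) hx

lemma exists_vertices_eq (n : SimplexCategory) {k : ℕ} {i : Fin (k + 1) → Fin (n.len + 1)}
    (hi : Monotone i) : ∃ x : (SSet.stdSimplex.{u}.obj n) _⦋k⦌, vertices x = i :=
  ⟨SSet.stdSimplex.objMk (m := op ⦋k⦌) ⟨i, hi⟩, rfl⟩

/-! ### Forms and chain maps with matching integrals -/

variable [CharZero K] (s : Gauge K) (n : SimplexCategory)

/-- `f` is the morphism from the chains of `Δⁿ` to `g[1]` which corresponds to `α`. -/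
def Corresponds (α : g.carrier ⊗[K] Forms K n.len)
    (f : normalizedChains K (SSet.stdSimplex.{u}.obj n) ⟶ g.shiftedComplex) : Prop :=
  ∀ (k : ℕ) (x : (SSet.stdSimplex.{u}.obj n) _⦋k⦌),
    chainValue f x = chainSign K k • g.contract (integral K (vertices x)) α

/-- The gauge condition and closedness put `α` in the image of Whitney's projection, so Stokes'
formula applies and turns closedness into the chain map equation for the signed integrals. -/
lemma exists_corresponds {α : g.carrier ⊗[K] Forms K n.len} (hα : α ∈ g.totalDegree n.len 1)
    (hd : g.totalDiff n.len α = 0) (hs : gaugeAction s g n.len α = 0) :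
    ∃ f, Corresponds n α f := by
  refine exists_chainValue_eq _ ?_ ?_ ?_ ?_
  · intro k x
    exact Submodule.smul_mem _ _ (g.contract_mem _ hα)
  · intro k x hx
    rw [g.contract_of_not_injective _ (not_injective_of_degenerate hx), smul_zero]
  · intro k x hx
    have h := contract_totalDiff ((mem_nonDegenerate_iff x).1 hx) hα
      (map_whitney_of_gaugeAction_eq_zero s hd hs)
    rw [hd, map_zero] at h
    rw [map_smul, ← smul_neg, neg_eq_of_add_eq_zero_right h.symm, chainSign_succ, mul_comm, mul_smul,
      smul_smul ((-1) ^ (k + 1)), ← mul_pow, neg_one_mul, neg_neg, one_pow, one_smul,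
      Finset.smul_sum]
    refine Finset.sum_congr rfl fun i _ => ?_
    rw [smul_comm, vertices_δ]
  · intro x
    have h := contract_totalDiff_vertex (vertices x) α
    rw [hd, map_zero] at h
    rw [map_smul, ← h, smul_zero]

lemma Corresponds.unique_right {α : g.carrier ⊗[K] Forms K n.len}
    {f f' : normalizedChains K (SSet.stdSimplex.{u}.obj n) ⟶ g.shiftedComplex}
    (h : Corresponds n α f) (h' : Corresponds n α f') : f = f' :=
  chainValue_ext fun k x _ => (h k x).trans (h' k x).symm

/-- Both elements are fixed by Whitney's projection, hence determined by their integrals over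
nondegenerate faces. -/
lemma Corresponds.unique_left {α β : g.carrier ⊗[K] Forms K n.len}
    {f : normalizedChains K (SSet.stdSimplex.{u}.obj n) ⟶ g.shiftedComplex}
    (hα : Corresponds n α f) (hβ : Corresponds n β f)
    (hdα : g.totalDiff n.len α = 0) (hsα : gaugeAction s g n.len α = 0)
    (hdβ : g.totalDiff n.len β = 0) (hsβ : gaugeAction s g n.len β = 0) : α = β := by
  rw [← map_whitney_of_gaugeAction_eq_zero s hdα hsα,
    ← map_whitney_of_gaugeAction_eq_zero s hdβ hsβ, map_whitney, map_whitney]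
  refine g.elementarySum_congr fun k i hi => ?_
  obtain ⟨x, rfl⟩ := exists_vertices_eq.{u} n hi.monotone
  rw [← chainSign_smul_smul k (g.contract _ α), ← hα, hβ, chainSign_smul_smul]

-- The inverse construction: the signed values of `f` on the faces serve as coefficients of the
-- elementary forms.
open Classical in
lemma exists_corresponds_left
    (f : normalizedChains K (SSet.stdSimplex.{u}.obj n) ⟶ g.shiftedComplex) :
    ∃ α, Corresponds n α f ∧ α ∈ g.totalDegree n.len 1 ∧ g.totalDiff n.len α = 0 ∧
      gaugeAction s g n.len α = 0 := by
  -- The sign is its own inverse. The value 0 at non-monotone tuples is irrelevant, as only strictly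
  -- increasing ones enter the sum.
  let a : ∀ k : ℕ, (Fin (k + 1) → Fin (n.len + 1)) → g.carrier := fun k i =>
    if hi : Monotone i then chainSign K k • chainValue f (exists_vertices_eq.{u} n hi).choose else 0
  have ha : ∀ (k : ℕ) (x : (SSet.stdSimplex.{u}.obj n) _⦋k⦌),
      a k (vertices x) = chainSign K k • chainValue f x := by
    intro k x
    have hx : Monotone (vertices x) := (SSet.stdSimplex.objEquiv x).toOrderHom.monotone
    have h : ∀ y, vertices y = vertices x →
        chainSign K k • chainValue f y = chainSign K k • chainValue f x := by
      intro y hy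
      have : y = x := SSet.stdSimplex.ext (n := n.len) y x (congrFun hy)
      rw [this]
    exact (dif_pos hx).trans (h _ (exists_vertices_eq.{u} n hx).choose_spec)
  have hmem : ∀ (k : ℕ) (i : Fin (k + 1) → Fin (n.len + 1)), StrictMono i →
      a k i ∈ g.gr (1 - k) := by
    intro k i hi
    obtain ⟨x, rfl⟩ := exists_vertices_eq.{u} n hi.monotone
    rw [ha]
    exact Submodule.smul_mem _ _ (chainValue_mem f x)
  refine ⟨g.elementarySum a, ?_, g.elementarySum_mem hmem, g.totalDiff_elementarySum s hmem ?_ ?_,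
    g.gaugeAction_elementarySum s⟩
  · intro k x
    -- On a degenerate simplex both sides vanish: its normalized chain is zero, and so is the
    -- integral over it.
    by_cases hx : x ∈ (SSet.stdSimplex.{u}.obj n).degenerate k
    · rw [g.contract_of_not_injective _ (not_injective_of_degenerate hx), smul_zero, chainValue,
        SSet.chainEval, SSet.ιNormalizedChainComplex_eq_zero _ x hx, Limits.zero_comp]
      rfl
    · rw [g.contract_elementarySum ((mem_nonDegenerate_iff x).1 hx), ha, chainSign_smul_smul]
  · intro i hi
    obtain ⟨x, rfl⟩ := exists_vertices_eq.{u} n hi.monotone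
    rw [ha, map_smul, delta_chainValue_vertex, smul_zero]
  · intro k i hi
    obtain ⟨x, rfl⟩ := exists_vertices_eq.{u} n hi.monotone
    have h := delta_chainValue f x
    simp only [← vertices_δ, ha, smul_comm ((-1 : K) ^ _) (chainSign K k)]
    rw [← Finset.smul_sum, ← h, map_smul, smul_smul, ← chainSign_succ, smul_neg, add_neg_cancel]

-- The integral of a pullback over a face is the integral over the image of that face. One statement
-- covers both the simplicial structure maps and naturality in the algebra.
variable {n} in
lemma Corresponds.map {g' : LInfinityAlgebra K} {m : SimplexCategory} (θ : m ⟶ n) (φ : g ⟶ g')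
    {α : g.carrier ⊗[K] Forms K n.len}
    {f : normalizedChains K (SSet.stdSimplex.{u}.obj n) ⟶ g.shiftedComplex}
    (h : Corresponds n α f) :
    Corresponds m (formsMap φ θ.toOrderHom α)
      (HomologicalComplex.extendMap (SSet.normalizedChainComplexMap (SSet.stdSimplex.{u}.map θ)
        (ModuleCat.of K K)) embeddingDownNat ≫ f ≫
        (shiftFunctor (CochainComplex (ModuleCat.{u} K) ℤ) (1 : ℤ)).map
          ((toCochainComplex K).map φ)) := by
  intro k x
  rw [← Category.assoc, chainValue_comp, chainValue_extendMap, h, contract_formsMap, map_smul,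
    vertices_map]

/-- The morphism from the chains of `Δⁿ` to `g[1]` which corresponds to a simplex of `γ•(g)`. -/
def gammaToChains (g : Abelian K) (n : SimplexCategoryᵒᵖ)
    (α : ((abelianToNilpotent K ⋙ gamma s).obj g).obj n) :
    normalizedChains K (SSet.stdSimplex.{u}.obj n.unop) ⟶ g.obj.shiftedComplex :=
  (exists_corresponds s n.unop α.1.2.1
    ((curvature_of_isAbelian g.property _).symm.trans α.1.2.2) α.2).choose

lemma corresponds_gammaToChains (g : Abelian K) (n : SimplexCategoryᵒᵖ)
    (α : ((abelianToNilpotent K ⋙ gamma s).obj g).obj n) :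
    Corresponds n.unop α.1.1 (gammaToChains s g n α) :=
  (exists_corresponds s n.unop α.1.2.1
    ((curvature_of_isAbelian g.property _).symm.trans α.1.2.2) α.2).choose_spec

lemma gammaToChains_bijective (g : Abelian K) (n : SimplexCategoryᵒᵖ) :
    Function.Bijective (gammaToChains s g n) := by
  refine ⟨fun α β h => ?_, fun f => ?_⟩
  · refine Subtype.ext (Subtype.ext ?_)
    exact Corresponds.unique_left s n.unop (corresponds_gammaToChains s g n α)
      (h ▸ corresponds_gammaToChains s g n β)
      ((curvature_of_isAbelian g.property _).symm.trans α.1.2.2) α.2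
      ((curvature_of_isAbelian g.property _).symm.trans β.1.2.2) β.2
  · obtain ⟨α, hα, hdeg, hd, hs⟩ := exists_corresponds_left s n.unop f
    let β : ((abelianToNilpotent K ⋙ gamma s).obj g).obj n :=
      ⟨⟨α, hdeg, (curvature_of_isAbelian g.property _).trans hd⟩, hs⟩
    exact ⟨β, (corresponds_gammaToChains s g n β).unique_right n.unop hα⟩

/-- For an abelian `L∞`-algebra `g`, the simplicial set `γ•(g)` is isomorphic to `K•(g[1])`. -/
def gammaIsoDoldKan (g : Abelian K) :
    (abelianToNilpotent K ⋙ gamma s).obj g ≅ (doldKan K).obj g.obj.shiftedComplex :=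
  NatIso.ofComponents
    (fun n => (Equiv.ofBijective (gammaToChains s g n) (gammaToChains_bijective s g n)).toIso)
    (by
      intro n m θ
      ext α
      -- A form has at most one corresponding chain map, so it is enough that both chain maps
      -- correspond to the restricted form.
      refine Corresponds.unique_right m.unop
        (corresponds_gammaToChains s g m (((abelianToNilpotent K ⋙ gamma s).obj g).map θ α)) ?_
      have h := (corresponds_gammaToChains s g n α).map θ.unop (𝟙 g.obj)
      have hid : (shiftFunctor (CochainComplex (ModuleCat.{u} K) ℤ) (1 : ℤ)).map
          ((toCochainComplex K).map (𝟙 g.obj)) = 𝟙 _ :=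
        (toCochainComplex K ⋙ shiftFunctor (CochainComplex (ModuleCat.{u} K) ℤ) (1 : ℤ)).map_id _
      rw [hid, Category.comp_id] at h
      exact h)

end Comparison

end LInfinityAlgebra

end

theorem mainTheorem8 (K : Type u) [Field K] [CharZero K] (s : PolyForm.Gauge K) :
    Nonempty
      (LInfinityAlgebra.abelianToNilpotent K ⋙ LInfinityAlgebra.gamma s ≅
        ObjectProperty.ι (fun g : LInfinityAlgebra K => g.IsAbelian) ⋙
          LInfinityAlgebra.toCochainComplex K ⋙
            shiftFunctor (CochainComplex (ModuleCat.{u} K) ℤ) (1 : ℤ) ⋙ doldKan K) := by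
  refine ⟨NatIso.ofComponents (fun g => LInfinityAlgebra.gammaIsoDoldKan s g) ?_⟩
  intro g g' φ
  ext n α
  -- Again by uniqueness: both chain maps correspond to the image of `α` under `φ`.
  refine LInfinityAlgebra.Corresponds.unique_right n.unop
    (LInfinityAlgebra.corresponds_gammaToChains s g' n
      (((LInfinityAlgebra.abelianToNilpotent K ⋙ LInfinityAlgebra.gamma s).map φ).app n α)) ?_
  have h := (LInfinityAlgebra.corresponds_gammaToChains s g n α).map (𝟙 n.unop) φ.hom
  have hid : HomologicalComplex.extendMap (SSet.normalizedChainComplexMap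
      (SSet.stdSimplex.{u}.map (𝟙 n.unop)) (ModuleCat.of K K)) ComplexShape.embeddingDownNat =
      𝟙 _ := (SSet.stdSimplex.{u} ⋙ SSet.normalizedChainComplexFunctorObj (ModuleCat.of K K) ⋙
        ComplexShape.embeddingDownNat.extendFunctor (ModuleCat.{u} K)).map_id _
  rw [hid, Category.id_comp] at h
  exact h
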